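/- Let $p$ be a prime, $e\ge 1$, $q=p^e$, and let $\mathcal A_q$ be the algebra of Steenrod $q$th powers: the $\mathbb F_q$-algebra generated by $P^r$, $r\ge 0$, subject to $P^0=1$ and the Adem relations $$P^aP^b=\sum_{j=0}^{\lfloor a/q\rfloor}(-1)^{a+j}\binom{(q-1)(b-j)-1}{a-qj}P^{a+b-j}P^j\qquad(a<qb).$$ Let $\mathcal A_q^+$ be its augmentation ideal, the kernel of the algebra homomorphism $\mathcal A_q\to\mathbb F_q$ with $P^r\mapsto 0$ for $r>0$. The May filtration of $\theta\in\mathcal A_q$ is $M(\theta)=\sup\{m\ge 0:\theta\in(\mathcal A_q^+)^m\}$; so $M(\theta)=m$ if $\theta\in(\mathcal A_q^+)^m$ and $\theta\notin(\mathcal A_q^+)^{m+1}$, and $M(0)=\infty$. Let $\mathcal A_p\otimes\mathbb F_q$ be the algebra of Steenrod $p$th powers with scalars extended to $\mathbb F_q$, regarded as a subalgebra of the linear dual of $\mathbb F_q[\xi_1,\xi_2,\ldots]$ with coproduct $\xi_n\mapsto\sum_{i=0}^n\xi_{n-i}^{p^i}\otimes\xi_i$ ($\xi_0=1$), and let $P(r_1,r_2,\ldots)$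 be its Milnor basis, dual to the basis of monomials $\xi_1^{r_1}\xi_2^{r_2}\cdots$. For a sequence $R=(r_1,r_2,\ldots)$ of non-negative integers with finitely many non-zero terms, let $P_e(R)=P(R_e)$, where $R_e$ has $r_k$ in position $ke$ for each $k\ge1$ and $0$ in all positions not divisible by $e$. The Milnor basis of $\mathcal A_q$ is the unique $\mathbb F_q$-basis, indexed by such $R$, consisting of elements $P(R)\in\mathcal A_q$ with $\rho(P(R))=P_e(R)$, where $\rho$ is the algebra homomorphism from $\mathcal A_q$ to this dual algebra with $\rho(P^r)=P_e(r,0,0,\ldots)$ for all $r\ge0$. Then this basis exists and is unique; every non-zero $\theta\in\mathcal A_q$ has finite May filtration; and for every $\theta=\sum_R c_R P(R)\in\mathcal A_q$, $$M(\theta)=\min\{M(P(R)) : c_R\ne 0\}$$ (with $\min\emptyset=\infty$ for $\theta=0$). -/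

import Mathlib

open scoped TensorProduct

noncomputable section

namespace Steenrod

/-! ## The algebra of Steenrod `q`th powers -/

section SteenrodAlgebra

variable (K : Type*) [Field K] (q : ℕ)

/-- The defining relations of the algebra of Steenrod `q`th powers: `P^0 = 1` and the Adem
relations. The generator `P^r` is `FreeAlgebra.ι K r`. All natural number subtractions below are
subtractions of a number from one that is at least as large, because `a < q * b` and
`j ≤ a / q < b`. -/
inductive AdemRel : FreeAlgebra K ℕ → FreeAlgebra K ℕ → Prop
  | zero : AdemRel (FreeAlgebra.ι K 0) 1
  | adem (a b : ℕ) (h : a < q * b) :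
      AdemRel (FreeAlgebra.ι K a * FreeAlgebra.ι K b)
        (∑ j ∈ Finset.range (a / q + 1),
          ((-1 : K) ^ (a + j) * (((q - 1) * (b - j) - 1).choose (a - q * j) : K)) •
            (FreeAlgebra.ι K (a + b - j) * FreeAlgebra.ι K j))

/-- The `K`-algebra generated by `P^r`, `r ≥ 0`, subject to `P^0 = 1` and the Adem relations.
For `K` the field with `q` elements this is the algebra of Steenrod `q`th powers. -/
abbrev SteenrodAlg : Type _ := RingQuot (AdemRel K q)

/-- The Steenrod power `P^r`. -/
def power (r : ℕ) : SteenrodAlg K q :=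
  RingQuot.mkAlgHom K (AdemRel K q) (FreeAlgebra.ι K r)

/-- The augmentation of the free algebra: `P^0 ↦ 1` and `P^r ↦ 0` for `r > 0`. -/
def freeAugmentation : FreeAlgebra K ℕ →ₐ[K] K :=
  FreeAlgebra.lift K (fun r : ℕ => if r = 0 then (1 : K) else 0)

theorem freeAugmentation_rel ⦃x y : FreeAlgebra K ℕ⦄ (h : AdemRel K q x y) :
    freeAugmentation K x = freeAugmentation K y := by
  cases h with
  | zero => simp [freeAugmentation]
  | adem a b h =>
    have hb : b ≠ 0 := by rintro rfl; simp at h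
    have hq : 0 < q := Nat.pos_of_ne_zero (by rintro rfl; simp at h)
    have hlt : a / q < b := Nat.div_lt_of_lt_mul h
    rw [map_sum, Finset.sum_eq_zero]
    · simp [freeAugmentation, hb]
    · intro j hj
      have hj' : j < b := by have := Finset.mem_range.1 hj; omega
      have : a + b - j ≠ 0 := by omega
      simp [freeAugmentation, this]

/-- The augmentation of the algebra of Steenrod `q`th powers: `P^r ↦ 0` for `r > 0`. -/
def augmentation : SteenrodAlg K q →ₐ[K] K :=
  RingQuot.liftAlgHom K ⟨freeAugmentation K, freeAugmentation_rel K q⟩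

/-- The augmentation ideal (a two-sided ideal, being a kernel). Its power `^ m` as an `Ideal` is
the ideal generated by the products of `m` of its elements, and its power `^ 0` is `⊤`. -/
def augIdeal : Ideal (SteenrodAlg K q) := RingHom.ker (augmentation K q)

variable {K q}

/-- The May filtration: the largest `m` such that `θ` lies in the `m`th power of the augmentation
ideal, and `⊤` if `θ` lies in all of these powers (as `θ = 0` does). -/
def mayFiltration (θ : SteenrodAlg K q) : ℕ∞ :=
  ⨆ (m : ℕ) (_ : θ ∈ augIdeal K q ^ m), (m : ℕ∞)

end SteenrodAlgebra

/-! ## Milnor's dual Hopf algebra -/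

section Milnor

/-- The polynomial algebra `K[ξ_1, ξ_2, …]`; the variable `ξ_n` is indexed by `n : ℕ+`.
It is a type synonym because its coalgebra structure depends on `p`. -/
def MilnorDual (_p : ℕ) (K : Type*) [Field K] : Type _ := MvPolynomial ℕ+ K

variable (p : ℕ) (K : Type*) [Field K]

instance : CommRing (MilnorDual p K) := inferInstanceAs (CommRing (MvPolynomial ℕ+ K))
instance : Algebra K (MilnorDual p K) := inferInstanceAs (Algebra K (MvPolynomial ℕ+ K))

/-- `ξ_n`, with `ξ_0 = 1`. -/
def xi (n : ℕ) : MilnorDual p K :=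
  if h : 0 < n then (MvPolynomial.X (⟨n, h⟩ : ℕ+) : MvPolynomial ℕ+ K) else 1

/-- Milnor's coproduct `ξ_n ↦ ∑_{i+j=n} ξ_j^{p^i} ⊗ ξ_i`. -/
def milnorComul : MilnorDual p K →ₐ[K] MilnorDual p K ⊗[K] MilnorDual p K :=
  MvPolynomial.aeval (R := K) (fun n : ℕ+ =>
    ∑ x ∈ Finset.HasAntidiagonal.antidiagonal (n : ℕ), (xi p K x.2 ^ p ^ x.1) ⊗ₜ[K] xi p K x.1)

/-- The counit `ξ_n ↦ 0` for `n ≥ 1`. -/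
def milnorCounit : MilnorDual p K →ₐ[K] K :=
  MvPolynomial.aeval (R := K) (fun _ : ℕ+ => (0 : K))

theorem xi_zero : xi p K 0 = 1 := rfl

theorem xi_pnat (n : ℕ+) : xi p K n = (MvPolynomial.X n : MvPolynomial ℕ+ K) := by
  exact dif_pos n.pos

theorem milnorComul_xi (n : ℕ) : milnorComul p K (xi p K n) =
    ∑ x ∈ Finset.HasAntidiagonal.antidiagonal n, (xi p K x.2 ^ p ^ x.1) ⊗ₜ[K] xi p K x.1 := by
  rcases Nat.eq_zero_or_pos n with rfl | h
  · simp [xi_zero, Algebra.TensorProduct.one_def]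
  · have := xi_pnat p K ⟨n, h⟩
    simp only [PNat.mk_coe] at this
    rw [this]
    exact MvPolynomial.aeval_X _ _

theorem milnorCounit_xi (n : ℕ) : milnorCounit p K (xi p K n) = if n = 0 then 1 else 0 := by
  rcases Nat.eq_zero_or_pos n with rfl | h
  · simp [xi_zero]
  · have := xi_pnat p K ⟨n, h⟩
    simp only [PNat.mk_coe] at this
    rw [this, if_neg h.ne']
    exact MvPolynomial.aeval_X _ _

variable {p K} in
theorem milnorDual_algHom_ext {A : Type*} [Semiring A] [Algebra K A]
    {f g : MilnorDual p K →ₐ[K] A} (h : ∀ n : ℕ, f (xi p K n) = g (xi p K n)) : f = g := by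
  refine MvPolynomial.algHom_ext (R := K) (σ := ℕ+) (f := f) (g := g) fun n => ?_
  have := h n
  rwa [xi_pnat] at this

theorem charP_milnorDual_tensor [CharP K p] : CharP (MilnorDual p K ⊗[K] MilnorDual p K) p := by
  have : Nontrivial (MilnorDual p K ⊗[K] MilnorDual p K) :=
    (Algebra.TensorProduct.lift (milnorCounit p K) (milnorCounit p K)
      (fun _ _ => Commute.all _ _)).toRingHom.domain_nontrivial
  exact charP_of_injective_algebraMap (algebraMap K _).injective p

variable [Fact p.Prime] [CharP K p]

theorem milnor_coassoc :
    (Algebra.TensorProduct.assoc K K K (MilnorDual p K) (MilnorDual p K)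
        (MilnorDual p K)).toAlgHom.comp
      ((Algebra.TensorProduct.map (milnorComul p K) (.id K (MilnorDual p K))).comp
        (milnorComul p K))
      = (Algebra.TensorProduct.map (.id K (MilnorDual p K)) (milnorComul p K)).comp
        (milnorComul p K) := by
  have := charP_milnorDual_tensor p K
  refine milnorDual_algHom_ext fun n => ?_
  have key : ∀ j i : ℕ, milnorComul p K (xi p K j ^ p ^ i) =
      ∑ y ∈ Finset.HasAntidiagonal.antidiagonal j,
        (xi p K y.2 ^ p ^ (i + y.1)) ⊗ₜ[K] (xi p K y.1 ^ p ^ i) := by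
    intro j i
    rw [map_pow, milnorComul_xi, sum_pow_char_pow]
    refine Finset.sum_congr rfl fun y _ => ?_
    rw [Algebra.TensorProduct.tmul_pow, ← pow_mul, ← pow_add, add_comm]
  simp only [AlgHom.comp_apply, milnorComul_xi, map_sum, Algebra.TensorProduct.map_tmul,
    AlgHom.id_apply, key, TensorProduct.sum_tmul, TensorProduct.tmul_sum]
  rw [Finset.sum_sigma', Finset.sum_sigma']
  refine Finset.sum_nbij' (fun z => ⟨(z.1.1 + z.2.1, z.2.2), (z.1.1, z.2.1)⟩)
    (fun z => ⟨(z.2.1, z.2.2 + z.1.2), (z.2.2, z.1.2)⟩) ?_ ?_ ?_ ?_ ?_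
  · rintro ⟨⟨i, j⟩, ⟨b, c⟩⟩ h
    simp only [Finset.mem_sigma, Finset.HasAntidiagonal.mem_antidiagonal] at h ⊢
    exact ⟨show i + b + c = n by omega, trivial⟩
  · rintro ⟨⟨i, j⟩, ⟨b, c⟩⟩ h
    simp only [Finset.mem_sigma, Finset.HasAntidiagonal.mem_antidiagonal] at h ⊢
    exact ⟨show b + (c + j) = n by omega, trivial⟩
  · rintro ⟨⟨i, j⟩, ⟨b, c⟩⟩ h
    simp only [Finset.mem_sigma, Finset.HasAntidiagonal.mem_antidiagonal] at h
    obtain ⟨-, rfl⟩ := h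
    rfl
  · rintro ⟨⟨i, j⟩, ⟨b, c⟩⟩ h
    simp only [Finset.mem_sigma, Finset.HasAntidiagonal.mem_antidiagonal] at h
    obtain ⟨-, rfl⟩ := h
    rfl
  · rintro ⟨⟨i, j⟩, ⟨b, c⟩⟩ _
    rfl

/-- Milnor's bialgebra structure on `K[ξ_1, ξ_2, …]`. -/
instance : Bialgebra K (MilnorDual p K) :=
  Bialgebra.ofAlgHom (milnorComul p K) (milnorCounit p K) (milnor_coassoc p K)
    (by
      refine milnorDual_algHom_ext fun n => ?_
      have hp : ∀ i : ℕ, p ^ i ≠ 0 := fun i => pow_ne_zero i (Fact.out : p.Prime).ne_zero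
      simp only [AlgHom.comp_apply, milnorComul_xi, map_sum, Algebra.TensorProduct.map_tmul,
        map_pow, milnorCounit_xi, AlgHom.id_apply]
      rw [Finset.sum_eq_single (n, 0)]
      · simp
      · rintro ⟨i, j⟩ h h'
        have hj : j ≠ 0 := by
          rintro rfl
          simp only [Finset.HasAntidiagonal.mem_antidiagonal, add_zero] at h
          exact h' (by rw [h])
        rw [if_neg hj, zero_pow (hp i), TensorProduct.zero_tmul]
      · simp [Finset.HasAntidiagonal.mem_antidiagonal])
    (by
      refine milnorDual_algHom_ext fun n => ?_
      simp only [AlgHom.comp_apply, milnorComul_xi, map_sum, Algebra.TensorProduct.map_tmul,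
        milnorCounit_xi, AlgHom.id_apply]
      rw [Finset.sum_eq_single (0, n)]
      · simp
      · rintro ⟨i, j⟩ h h'
        have hi : i ≠ 0 := by
          rintro rfl
          simp only [Finset.HasAntidiagonal.mem_antidiagonal, zero_add] at h
          exact h' (by rw [h])
        simp [hi]
      · simp [Finset.HasAntidiagonal.mem_antidiagonal])

/-- The dual of Milnor's coalgebra with the convolution product
`(f * g)(x) = ∑ f(x₍₁₎) g(x₍₂₎)`. The span in it of the elements `milnorElt p K R` below is (the
scalar extension to `K` of) the algebra of Steenrod `p`th powers. -/
abbrev MilnorAlg : Type _ := WithConv (MilnorDual p K →ₗ[K] K)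

/-- The Milnor basis element `P(R) = P(r_1, r_2, …)` of the algebra of Steenrod `p`th powers: the
element dual to `ξ^R = ξ_1^{r_1} ξ_2^{r_2} ⋯` with respect to the basis of monomials. -/
def milnorElt (R : ℕ+ →₀ ℕ) : MilnorAlg p K :=
  WithConv.toConv (MvPolynomial.lcoeff K R : MvPolynomial ℕ+ K →ₗ[K] K)

/-- `P_e(R) = P(R_e)`, where `R_e` has `r_k` in position `k * e` for all `k ≥ 1` and `0` in the
positions that are not multiples of `e`. -/
def milnorEltStretch (e : ℕ+) (R : ℕ+ →₀ ℕ) : MilnorAlg p K :=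
  milnorElt p K (R.mapDomain (fun k => k * e))

/-- `b` is the Milnor basis of the algebra of Steenrod `q`th powers, `q = p ^ e`: the algebra
homomorphism `ρ` defined by `ρ(P^r) = P_e(r)` exists and maps `b R = P(R)` to `P_e(R)`. -/
def IsMilnorBasis (e : ℕ+)
    (b : Module.Basis (ℕ+ →₀ ℕ) K (SteenrodAlg K (p ^ (e : ℕ)))) : Prop :=
  ∃ ρ : SteenrodAlg K (p ^ (e : ℕ)) →ₐ[K] MilnorAlg p K,
    (∀ r : ℕ, ρ (power K (p ^ (e : ℕ)) r) = milnorEltStretch p K e (Finsupp.single 1 r)) ∧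
    ∀ R : ℕ+ →₀ ℕ, ρ (b R) = milnorEltStretch p K e R

end Milnor

end Steenrod

end

/-! Write q = p^e, let s(r) be the sum of the base p digits of r, and give R the weight w(R) = ∑ k
s(r_k). The theorem follows from a description of the powers of the augmentation ideal: the m-th
power is exactly the span of the P(R) with w(R) ≥ m (`mem_augIdeal_pow_iff`). Hence M(P(R)) = w(R),
and θ lies in the m-th power if and only if every P(R) occurring in θ does.

For one inclusion, w(R) + w(S) ≤ w(T) whenever P(T) occurs in P(R)P(S) (`structConst_ne_zero`). The
coefficient is read off the coproduct of ξ^T. Splitting the exponents into base p digits and using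
Frobenius, this coproduct is a product of sums of terms ξ_b^{q^a p^j} ⊗ ξ_a^{p^j} (indices in units
of e) with a + b = k. Each such term has total weight k, and adding exponents can only lower digit
sums.

For the other, P(T) lies in the power of exponent w(T) (`milnorEltStretch_mem_augPowImage`), by
induction. If T has several digits, one digit R is split off, T = R + S. Then P(T) occurs in
P(R)P(S) with a binomial coefficient that is prime to p because there are no carries, and every
other term has larger weight, or equal weight and fewer digits. If T is a single digit p^j in
position k + 1, it is obtained from the commutator of the elements with q p^j in position k and p^j
in position 1: the two-digit terms of lowest weight cancel and P(T) survives with coefficient 1. A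
digit in position 1 is a generator.

The homomorphism ρ exists because the P_e(r) satisfy the Adem relations (`adem_milnorElt`), which
comes down to the binomial identity `sum_choose_mul_choose`. Admissible monomials span the Steenrod
algebra and are indexed by the same R in the same degrees as the Milnor elements. By the generation
argument their images span all P_e(T), so a dimension count in each degree makes ρ injective
(`injective_of_map_power`). As injectivity depends on it, the generation argument is carried out in
Milnor's algebra, with images of the powers of the ideal. -/

open scoped TensorProduct

noncomputable section

namespace Steenrod

/-! ### The binomial identity behind the Adem relations, by power series residues -/

section AdemBinomial

open PowerSeries

/-- The residue of `u ^ (-a - 1) * u'` vanishes for `a ≥ 1`, where `u = X * g` and `f = g⁻¹`. -/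
theorem coeff_pow_mul_derivative_eq_zero {R : Type*} [CommRing R] [IsDomain R] [CharZero R]
    (f g : R⟦X⟧) (h : f * g = 1) (a : ℕ) :
    coeff (a + 1) (f ^ (a + 2) * (g + X * derivative R g)) = 0 := by
  have h1 : f * derivative R g = - (g * derivative R f) := by
    have := congrArg (derivative R) h
    simp only [Derivation.leibniz, smul_eq_mul, Derivation.map_one_eq_zero] at this
    linear_combination this
  have h2 : f ^ (a + 2) * (g + X * derivative R g) =
      f ^ (a + 1) - X * (f ^ a * derivative R f) := by
    linear_combination (f ^ (a + 1) - X * f ^ a * derivative R f) * h + X * f ^ (a + 1) * h1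
  rw [h2, map_sub, coeff_succ_X_mul]
  have h3 : coeff a (derivative R (f ^ (a + 1))) =
      ((a : R) + 1) * coeff a (f ^ a * derivative R f) := by
    rw [Derivation.leibniz_pow, Nat.add_sub_cancel, smul_eq_mul, nsmul_eq_mul,
      ← map_natCast (C (R := R)), coeff_C_mul]
    push_cast
    rfl
  rw [coeff_derivative, mul_comm] at h3
  -- Cancelling a + 1 is what requires characteristic zero.
  have h4 : ((a : R) + 1) ≠ 0 := by exact_mod_cast Nat.succ_ne_zero a
  rw [sub_eq_zero]
  exact mul_left_cancel₀ h4 h3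

variable {K : Type*} [Field K] {q : ℕ}

/-- With u = X (1 - X^q) / (1 - X^(q+1)) and q = 0 in K, the derivative of u is (1 - X^q) B^2. The
series in question is therefore (X/u)^(a+2) u', whose coefficient is a residue of an exact form. The
residue lemma needs characteristic zero, so it is applied over ℤ and then reduced to K. -/
theorem coeff_residue_eq_zero (hq : 0 < q) (hqK : (q : K) = 0) {A B : K⟦X⟧}
    (hA : A * (1 - X ^ q) = 1) (hB : B * (1 - X ^ (q + 1)) = 1) (a : ℕ) :
    coeff (a + 1) (((1 - X ^ (q + 1)) * A) ^ (a + 1) * B) = 0 := by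
  have hunit : ∀ n : ℕ, 0 < n → ∃ A : ℤ⟦X⟧, A * (1 - X ^ n) = 1 := fun n hn => by
    have : IsUnit (1 - X ^ n : ℤ⟦X⟧) := by
      rw [isUnit_iff_constantCoeff]
      simp [hn.ne']
    obtain ⟨u, hu⟩ := this
    exact ⟨↑u⁻¹, by rw [← hu]; simp⟩
  obtain ⟨A', hA'⟩ := hunit q hq
  obtain ⟨B', hB'⟩ := hunit (q + 1) q.succ_pos
  let φ : ℤ⟦X⟧ →+* K⟦X⟧ := PowerSeries.map (Int.castRingHom K)
  have hφA : φ A' = A := by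
    have := congrArg φ hA'
    simp only [map_mul, map_sub, map_one, map_pow, φ, map_X] at this
    calc φ A' = φ A' * (A * (1 - X ^ q)) := by rw [hA, mul_one]
      _ = A * (φ A' * (1 - X ^ q)) := by ring
      _ = A := by rw [this, mul_one]
  have hφB : φ B' = B := by
    have := congrArg φ hB'
    simp only [map_mul, map_sub, map_one, map_pow, φ, map_X] at this
    calc φ B' = φ B' * (B * (1 - X ^ (q + 1))) := by rw [hB, mul_one]
      _ = B * (φ B' * (1 - X ^ (q + 1))) := by ring
      _ = B := by rw [this, mul_one]
  have key := coeff_pow_mul_derivative_eq_zero ((1 - X ^ (q + 1)) * A') ((1 - X ^ q) * B')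
    (by linear_combination (1 - X ^ q) * A' * hB' + hA') a
  have hd : ∀ n : ℕ, derivative ℤ (X ^ (n + 1) : ℤ⟦X⟧) = ((n : ℤ⟦X⟧) + 1) * X ^ n := fun n => by
    rw [Derivation.leibniz_pow]
    simp
  have hdB : derivative ℤ B' = ((q : ℤ⟦X⟧) + 1) * X ^ q * B' ^ 2 := by
    have := congrArg (derivative ℤ) hB'
    simp only [Derivation.leibniz, smul_eq_mul, Derivation.map_one_eq_zero, map_sub, hd] at this
    linear_combination B' * this - derivative ℤ B' * hB'
  have hdq : ∃ s, derivative ℤ (X ^ q : ℤ⟦X⟧) = (q : ℤ⟦X⟧) * s := by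
    obtain ⟨n, rfl⟩ : ∃ n, q = n + 1 := ⟨q - 1, by omega⟩
    exact ⟨X ^ n, by rw [hd]; push_cast; rfl⟩
  obtain ⟨s, hs⟩ := hdq
  have key' := congrArg (Int.castRingHom K) key
  rw [map_zero, ← coeff_map] at key'
  change coeff (a + 1) (φ _) = 0 at key'
  have hφq : φ (q : ℤ⟦X⟧) = 0 := by
    rw [map_natCast, ← map_natCast (C (R := K)), hqK, map_zero]
  simp only [Derivation.leibniz, smul_eq_mul, Derivation.map_one_eq_zero, map_sub, hs, hdB] at key'
  simp only [map_mul, map_sub, map_one, map_pow, map_add, map_neg, hφA, hφB, hφq, zero_sub] at key'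
  have hX : φ X = X := map_X _
  rw [hX] at key'
  rw [← key']
  congr 1
  have hE : 1 + X ^ (q + 1) * B = B := by linear_combination -hB
  linear_combination ((1 - X ^ (q + 1)) * A) ^ (a + 1) * (((1 - X ^ (q + 1)) * B - B) * hB -
    (1 - X ^ (q + 1)) * (B + X ^ (q + 1) * B ^ 2) * hA)

/-- In characteristic `p`, with `u = X (1 - X ^ q) / (1 - X ^ (q + 1))`, the coefficient of `X ^ a`
in `(X / u) ^ a (1 - u) ^ (-b) (1 - X)⁻¹` is the coefficient of `u ^ a` in `(1 - u) ^ (-b - 1)`. -/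
theorem coeff_substitution (hq : 0 < q) (hqK : (q : K) = 0) {A C : K⟦X⟧}
    (hA : A * (1 - X ^ q) = 1) (hC : C * (1 - X) = 1) (a b : ℕ) :
    coeff a (((1 - X ^ (q + 1)) * A) ^ a * ((1 - X ^ (q + 1)) * C) ^ b * C) =
      ((a + b).choose a : K) := by
  have hC0 : constantCoeff C = 1 := by simpa using congrArg constantCoeff hC
  obtain ⟨B, hB⟩ : ∃ B : K⟦X⟧, B * (1 - X ^ (q + 1)) = 1 :=
    ⟨(1 - X ^ (q + 1))⁻¹, PowerSeries.inv_mul_cancel _ (by simp)⟩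
  induction a generalizing b with
  | zero => simp [hC0]
  | succ a iha =>
    set F := (1 - X ^ (q + 1)) * A with hF
    set H := (1 - X ^ (q + 1)) * C with hH
    have hFg : F * ((1 - X ^ q) * B) = 1 := by
      rw [hF]; linear_combination (1 - X ^ q) * A * hB + hA
    have hHh : H * ((1 - X) * B) = 1 := by
      rw [hH]; linear_combination (1 - X) * C * hB + hC
    -- This is u + (1 - u) = 1, with F = X/u and H = 1/(1 - u). Multiplied by F^(a+1) H^(b+1) C it
    -- becomes Pascal's recurrence; for exponent 0 of H the extra term is the vanishing residue.
    have hsum : X * ((1 - X ^ q) * B) + (1 - X) * B = 1 := by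
      linear_combination hB
    clear_value F H
    induction b with
    | zero =>
      have h1 : F ^ (a + 1) * H ^ 0 * C = X * (F ^ a * H ^ 0 * C) + F ^ (a + 1) * B := by
        linear_combination -F ^ (a + 1) * C * hsum + X * F ^ a * C * hFg + F ^ (a + 1) * B * hC
      rw [h1, map_add, coeff_succ_X_mul, hF, coeff_residue_eq_zero hq hqK hA hB, ← hF, add_zero, iha 0]
      simp
    | succ b ihb =>
      have h1 : F ^ (a + 1) * H ^ (b + 1) * C =
          X * (F ^ a * H ^ (b + 1) * C) + F ^ (a + 1) * H ^ b * C := by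
        linear_combination -F ^ (a + 1) * H ^ (b + 1) * C * hsum + X * F ^ a * H ^ (b + 1) * C * hFg
          + F ^ (a + 1) * H ^ b * C * hHh
      rw [h1, map_add, coeff_succ_X_mul, iha, ihb, ← Nat.cast_add]
      congr 1
      rw [show a + 1 + (b + 1) = (a + (b + 1)) + 1 by ring, Nat.choose_succ_succ,
        show a + (b + 1) = a + 1 + b by ring]

/-- The binomial identity behind the Adem relations. -/
theorem sum_choose_mul_choose (p e : ℕ) [Fact p.Prime] [CharP K p] (he : 0 < e) (hqe : q = p ^ e)
    {a b : ℕ} (hab : a < q * b) :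
    ∑ j ∈ Finset.range (a / q + 1), (-1 : K) ^ (a + j) *
        (((q - 1) * (b - j) - 1).choose (a - q * j) : K) * ((a + b).choose j : K) =
      ((a + b).choose a : K) := by
  have hp : p.Prime := Fact.out
  have hq2 : 2 ≤ q := hqe ▸ hp.two_le.trans (Nat.le_self_pow he.ne' p)
  have hq : 0 < q := by omega
  have hqK : (q : K) = 0 := by rw [hqe, Nat.cast_pow, CharP.cast_eq_zero, zero_pow he.ne']
  have hsign : (-1 : K) ^ q = -1 := by
    rw [hqe, ← zero_sub, sub_pow_char_pow, zero_pow (pow_ne_zero _ hp.ne_zero), one_pow]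
  have : CharP K⟦X⟧ p := charP_of_injective_algebraMap (algebraMap K K⟦X⟧).injective p
  have hfrob : (1 - X ^ q : K⟦X⟧) = (1 - X) ^ q := by
    rw [hqe, sub_pow_char_pow, one_pow]
  obtain ⟨C, hC⟩ : ∃ C : K⟦X⟧, C * (1 - X) = 1 :=
    ⟨(1 - X)⁻¹, PowerSeries.inv_mul_cancel _ (by simp)⟩
  have hA : C ^ q * (1 - X ^ q) = 1 := by rw [hfrob, ← mul_pow, hC, one_pow]
  have hcancel : ∀ m n : ℕ, C ^ m * (1 - X) ^ (m + n) = (1 - X) ^ n := fun m n => by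
    rw [pow_add, ← mul_assoc, ← mul_pow, hC, one_pow, one_mul]
  rw [← coeff_substitution hq hqK hA hC a b]
  -- Since 1 - X^q = (1 - X)^q, the series 1 - X^(q+1) factors as (1 - X)(X^q + (1 - X)^(q-1)).
  -- Expanding the power of the second factor binomially produces the summands indexed by j.
  have hprod : ((1 - X ^ (q + 1)) * C ^ q) ^ a * ((1 - X ^ (q + 1)) * C) ^ b * C =
      C ^ ((q - 1) * a + 1) * (X ^ q + (1 - X) ^ (q - 1)) ^ (a + b) := by
    have h1 : (1 - X ^ (q + 1) : K⟦X⟧) = (1 - X) * (X ^ q + (1 - X) ^ (q - 1)) := by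
      have : (1 - X : K⟦X⟧) ^ (q - 1) * (1 - X) = 1 - X ^ q := by
        rw [← pow_succ, Nat.sub_add_cancel hq, hfrob]
      linear_combination -this
    have h2 : (1 - X ^ (q + 1)) * C = X ^ q + (1 - X) ^ (q - 1) := by
      rw [h1]; linear_combination (X ^ q + (1 - X) ^ (q - 1)) * hC
    have h3 : (1 - X ^ (q + 1)) * C ^ q = C ^ (q - 1) * (X ^ q + (1 - X) ^ (q - 1)) := by
      have hCq : C ^ q = C ^ (q - 1) * C := by rw [← pow_succ, Nat.sub_add_cancel hq]
      rw [← h2]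
      linear_combination (1 - X ^ (q + 1)) * hCq
    rw [h2, h3, mul_pow, ← pow_mul]
    ring
  rw [hprod, add_pow, Finset.mul_sum, map_sum]
  have hdiv : a / q < b := Nat.div_lt_of_lt_mul hab
  have hterm : ∀ j ∈ Finset.range (a / q + 1), (-1 : K) ^ (a + j) *
      (((q - 1) * (b - j) - 1).choose (a - q * j) : K) * ((a + b).choose j : K) =
      coeff a (C ^ ((q - 1) * a + 1) * ((X ^ q) ^ j * ((1 - X) ^ (q - 1)) ^ (a + b - j) *
        ((a + b).choose j : K⟦X⟧))) := by
    intro j hj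
    have hja : j ≤ a / q := Nat.lt_succ_iff.1 (Finset.mem_range.1 hj)
    have hqj : q * j ≤ a := (Nat.mul_le_mul_left q hja).trans (Nat.mul_div_le a q)
    have hjb : j < b := hja.trans_lt hdiv
    have hexp : (q - 1) * (a + b - j) = ((q - 1) * a + 1) + ((q - 1) * (b - j) - 1) := by
      have h1 : 1 ≤ (q - 1) * (b - j) := Nat.one_le_iff_ne_zero.2
        (Nat.mul_ne_zero (by omega) (by omega))
      rw [Nat.add_sub_assoc hjb.le, Nat.mul_add]
      omega
    have h1 : C ^ ((q - 1) * a + 1) * ((X ^ q) ^ j * ((1 - X) ^ (q - 1)) ^ (a + b - j) *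
        ((a + b).choose j : K⟦X⟧)) = ((1 - X) ^ ((q - 1) * (b - j) - 1) *
          ((a + b).choose j : K⟦X⟧)) * X ^ (q * j) := by
      rw [← pow_mul, ← pow_mul, hexp]
      linear_combination X ^ (q * j) * ((a + b).choose j : K⟦X⟧) *
        hcancel ((q - 1) * a + 1) ((q - 1) * (b - j) - 1)
    rw [h1, coeff_mul_X_pow', if_pos hqj, ← map_natCast (PowerSeries.C (R := K)), coeff_mul_C]
    congr 1
    have h2 : ((1 - X : K⟦X⟧) ^ ((q - 1) * (b - j) - 1)) =
        ((((1 : Polynomial K) - Polynomial.X) ^ ((q - 1) * (b - j) - 1) : Polynomial K) : K⟦X⟧) := by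
      simp
    have h3 : ∀ m n : ℕ, ((1 - Polynomial.X : Polynomial K) ^ m).coeff n =
        (-1) ^ n * (m.choose n : K) := fun m n => by
      have : (1 - Polynomial.X : Polynomial K) ^ m =
          ((1 + Polynomial.X) ^ m).comp (Polynomial.C (-1) * Polynomial.X) := by
        simp [sub_eq_add_neg]
      rw [this, Polynomial.comp_C_mul_X_coeff, Polynomial.coeff_one_add_X_pow, mul_comm]
    rw [h2, Polynomial.coeff_coe, h3]
    congr 1
    -- The sign (-1)^(a+j) agrees with (-1)^(a-qj) because (-1)^(q+1) = 1 in K, also when p = 2.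
    have h4 : a + j = (a - q * j) + (q + 1) * j := by
      have : (q + 1) * j = q * j + j := by ring
      omega
    rw [h4, pow_add, pow_mul, pow_succ, hsign]
    simp
  rw [Finset.sum_congr rfl hterm]
  have hvanish : ∀ j, a / q < j → coeff a (C ^ ((q - 1) * a + 1) * ((X ^ q) ^ j *
      ((1 - X) ^ (q - 1)) ^ (a + b - j) * ((a + b).choose j : K⟦X⟧))) = 0 := by
    intro j hj
    have hlt : a < q * j := by rw [mul_comm]; exact (Nat.div_lt_iff_lt_mul hq).1 hj
    rw [show C ^ ((q - 1) * a + 1) * ((X ^ q) ^ j * ((1 - X) ^ (q - 1)) ^ (a + b - j) *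
      ((a + b).choose j : K⟦X⟧)) = (C ^ ((q - 1) * a + 1) * (((1 - X) ^ (q - 1)) ^ (a + b - j) *
      ((a + b).choose j : K⟦X⟧))) * X ^ (q * j) by rw [pow_mul]; ring, coeff_mul_X_pow',
      if_neg hlt.not_ge]
  have hdiv' : a / q ≤ a := Nat.div_le_self a q
  refine Finset.sum_subset (fun j hj => ?_) (fun j _ hj => hvanish j ?_)
  · rw [Finset.mem_range] at hj ⊢
    omega
  · rw [Finset.mem_range] at hj
    omega

end AdemBinomial

/-! ### Evaluating convolution products by algebra homomorphisms -/

section Convolution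

variable {p : ℕ} {K : Type*} [Field K]

variable (p K) in
/-- The monomial `ξ_1 ^ T_1 ξ_2 ^ T_2 ⋯`. -/
def xiMonomial (T : ℕ+ →₀ ℕ) : MilnorDual p K := T.prod fun n t => xi p K n ^ t

theorem xiMonomial_eq (T : ℕ+ →₀ ℕ) :
    xiMonomial p K T = (MvPolynomial.monomial T (1 : K) : MvPolynomial ℕ+ K) := by
  simp only [xiMonomial, xi_pnat]
  exact (MvPolynomial.monic_monomial_eq T).symm

theorem algHom_xiMonomial {M : Type*} [CommSemiring M] [Algebra K M] (Φ : MilnorDual p K →ₐ[K] M)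
    (T : ℕ+ →₀ ℕ) : Φ (xiMonomial p K T) = T.prod fun n t => Φ (xi p K n) ^ t := by
  rw [xiMonomial, Finsupp.prod, map_prod]
  simp only [map_pow, Finsupp.prod]

theorem milnorDual_linearMap_ext {N : Type*} [AddCommMonoid N] [Module K N]
    {f g : MilnorDual p K →ₗ[K] N} (h : ∀ T, f (xiMonomial p K T) = g (xiMonomial p K T)) :
    f = g := by
  refine (MvPolynomial.basisMonomials ℕ+ K).ext fun T => ?_
  have hT : xiMonomial p K T = MvPolynomial.basisMonomials ℕ+ K T := by
    rw [xiMonomial_eq, MvPolynomial.coe_basisMonomials]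
  exact (congrArg f hT).symm.trans ((h T).trans (congrArg g hT))

theorem milnorAlg_ext {f g : MilnorAlg p K}
    (h : ∀ T, f.ofConv (xiMonomial p K T) = g.ofConv (xiMonomial p K T)) : f = g := by
  exact WithConv.ofConv_injective (milnorDual_linearMap_ext h)

theorem milnorElt_apply (R : ℕ+ →₀ ℕ) (f : MilnorDual p K) :
    (milnorElt p K R).ofConv f = MvPolynomial.coeff (R := K) (σ := ℕ+) R f := rfl

theorem milnorElt_apply_xiMonomial (R T : ℕ+ →₀ ℕ) :
    (milnorElt p K R).ofConv (xiMonomial p K T) = if T = R then 1 else 0 := by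
  rw [milnorElt_apply, xiMonomial_eq, MvPolynomial.coeff_monomial]

theorem milnorEltStretch_single (e : ℕ+) (r : ℕ) :
    milnorEltStretch p K e (Finsupp.single 1 r) = milnorElt p K (Finsupp.single e r) := by
  rw [milnorEltStretch, Finsupp.mapDomain_single, one_mul]

variable (p) in
/-- The algebra homomorphism `f ↦ ∑ l(f₍₁₎) r(f₍₂₎)`. -/
def convHom {M : Type*} [CommRing M] [Algebra K M] (l r : MilnorDual p K →ₐ[K] M) :
    MilnorDual p K →ₐ[K] M :=
  (Algebra.TensorProduct.lift l r fun _ _ => Commute.all _ _).comp (milnorComul p K)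

theorem convHom_xi {M : Type*} [CommRing M] [Algebra K M] (l r : MilnorDual p K →ₐ[K] M) (n : ℕ) :
    convHom p l r (xi p K n) = ∑ x ∈ Finset.HasAntidiagonal.antidiagonal n,
      l (xi p K x.2) ^ p ^ x.1 * r (xi p K x.1) := by
  simp [convHom, milnorComul_xi]

variable [Fact p.Prime] [CharP K p]

/-- If f ⊗ g factors through a commutative algebra M as a functional h after two homomorphisms, then
the product f * g is h after one homomorphism. It can then be evaluated multiplicatively on
monomials. -/
theorem conv_apply_eq {M : Type*} [CommRing M] [Algebra K M] (l r : MilnorDual p K →ₐ[K] M)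
    (h : M →ₗ[K] K) (f g : MilnorAlg p K)
    (hfg : ∀ a b, h (l a * r b) = f.ofConv a * g.ofConv b) (c : MilnorDual p K) :
    (f * g).ofConv c = h (convHom p l r c) := by
  rw [LinearMap.convMul_apply]
  change LinearMap.mul' K K (TensorProduct.map f.ofConv g.ofConv (milnorComul p K c)) =
    h (Algebra.TensorProduct.lift l r (fun _ _ => Commute.all _ _) (milnorComul p K c))
  induction milnorComul p K c using TensorProduct.induction_on with
  | zero => simp
  | tmul a b => simp [hfg]
  | add x y hx hy => simp only [map_add, hx, hy]

end Convolution

/-! ### The Adem relations in Milnor's algebra and the homomorphism to it -/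

section Adem

open Polynomial

variable (p : ℕ) (K : Type*) [Field K]

/-- The restriction of polynomials to the line of the coordinate `ξ_e`. -/
def lineRestrict (e : ℕ+) {M : Type*} [CommRing M] [Algebra K M] (x : M) :
    MilnorDual p K →ₐ[K] M :=
  MvPolynomial.aeval (R := K) (fun n : ℕ+ => if n = e then x else 0)

theorem lineRestrict_xi (e : ℕ+) {M : Type*} [CommRing M] [Algebra K M] (x : M) (n : ℕ) :
    lineRestrict p K e x (xi p K n) = if n = 0 then 1 else if n = e then x else 0 := by
  rcases Nat.eq_zero_or_pos n with rfl | h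
  · simp [xi_zero]
  · have := xi_pnat p K ⟨n, h⟩
    simp only [PNat.mk_coe] at this
    rw [this, if_neg h.ne']
    refine (MvPolynomial.aeval_X _ _).trans ?_
    by_cases hn : n = e
    · rw [if_pos hn]
      exact if_pos (PNat.eq (m := ⟨n, h⟩) hn)
    · rw [if_neg hn]
      exact if_neg fun h' => hn (show PNat.val ⟨n, h⟩ = e from congrArg PNat.val h')

theorem lineRestrict_algHom (e : ℕ+) {M N : Type*} [CommRing M] [Algebra K M] [CommRing N]
    [Algebra K N] (φ : M →ₐ[K] N) (x : M) (f : MilnorDual p K) :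
    φ (lineRestrict p K e x f) = lineRestrict p K e (φ x) f := by
  have : φ.comp (lineRestrict p K e x) = lineRestrict p K e (φ x) := by
    refine milnorDual_algHom_ext fun n => ?_
    simp only [AlgHom.comp_apply, lineRestrict_xi]
    split_ifs <;> simp
  exact DFunLike.congr_fun this f

theorem coeff_lineRestrict (e : ℕ+) (a : ℕ) (f : MilnorDual p K) :
    (lineRestrict p K e (X : K[X]) f).coeff a =
      MvPolynomial.coeff (R := K) (σ := ℕ+) (Finsupp.single e a) f := by
  have : (Polynomial.lcoeff K a) ∘ₗ (lineRestrict p K e (X : K[X])).toLinearMap =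
      (milnorElt p K (Finsupp.single e a)).ofConv := by
    refine milnorDual_linearMap_ext fun T => ?_
    change (lineRestrict p K e (X : K[X]) (xiMonomial p K T)).coeff a =
      (milnorElt p K _).ofConv (xiMonomial p K T)
    rw [algHom_xiMonomial, milnorElt_apply_xiMonomial]
    by_cases hT : ∃ t, T = Finsupp.single e t
    · obtain ⟨t, rfl⟩ := hT
      rw [Finsupp.prod_single_index (by simp), lineRestrict_xi, if_neg e.ne_zero, if_pos rfl,
        coeff_X_pow]
      simp only [(Finsupp.single_injective e).eq_iff, eq_comm]
    · rw [if_neg (fun h => hT ⟨a, h⟩)]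
      obtain ⟨n, hn, hne⟩ : ∃ n ∈ T.support, n ≠ e := by
        by_contra! h
        exact hT ⟨T e, Finsupp.support_subset_singleton.1 fun n hn => by simp [h n hn]⟩
      rw [Finsupp.prod, Finset.prod_eq_zero hn, coeff_zero]
      rw [lineRestrict_xi, if_neg n.ne_zero, if_neg (by simpa using hne),
        zero_pow (Finsupp.mem_support_iff.1 hn)]
  exact LinearMap.congr_fun this f

variable [Fact p.Prime]

/-- Write x for the inner variable (left factor) and y for the outer one (right factor). When only
ξ_e survives in each factor, the coproduct has just the values ξ_e ↦ x + y and ξ_{2e} ↦ x^q y.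
Products of two Steenrod powers are therefore determined by the coefficients of (x + y)^t (x^q y)^u.
-/
theorem lineRestrict_conv_xi (e n : ℕ+) :
    convHom p (lineRestrict p K e (C X : K[X][X])) (lineRestrict p K e (X : K[X][X])) (xi p K n) =
      if n = e then X + C X else if n = 2 * e then C (X ^ p ^ (e : ℕ)) * X else 0 := by
  have hp : ∀ i : ℕ, p ^ i ≠ 0 := fun i => pow_ne_zero i (Fact.out : p.Prime).ne_zero
  have he := e.pos
  have hn := n.pos
  rw [convHom_xi]
  simp only [lineRestrict_xi]
  split_ifs with h1 h2
  · subst h1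
    rw [Finset.sum_eq_add_of_mem (0, (n : ℕ)) ((n : ℕ), 0) (by simp) (by simp) (by simp)]
    · simp [hn.ne', add_comm]
    · rintro ⟨i, j⟩ h ⟨h3, h4⟩
      simp only [Finset.HasAntidiagonal.mem_antidiagonal] at h
      simp only [ne_eq, Prod.mk.injEq, not_and] at h3 h4
      have hi : i ≠ 0 := fun hi => h3 hi (by omega)
      have hj : j ≠ 0 := fun hj => h4 (by omega) hj
      rw [if_neg hj, if_neg (by omega : j ≠ n), zero_pow (hp _), zero_mul]
  · have h2' : (n : ℕ) = 2 * e := by rw [h2]; rfl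
    rw [Finset.sum_eq_single ((e : ℕ), (e : ℕ))]
    · simp [he.ne']
    · rintro ⟨i, j⟩ h h3
      simp only [Finset.HasAntidiagonal.mem_antidiagonal] at h
      simp only [ne_eq, Prod.mk.injEq, not_and] at h3
      have hi : i ≠ e := fun hi => h3 hi (by omega)
      have hj : j ≠ e := fun hj => h3 (by omega) hj
      by_cases hj0 : j = 0
      · rw [if_neg (by omega : i ≠ 0), if_neg hi, mul_zero]
      · rw [if_neg hj0, if_neg hj, zero_pow (hp _), zero_mul]
    · simp only [Finset.HasAntidiagonal.mem_antidiagonal]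
      intro h
      exact (h (by omega)).elim
  · refine Finset.sum_eq_zero ?_
    rintro ⟨i, j⟩ h
    simp only [Finset.HasAntidiagonal.mem_antidiagonal] at h
    have h1' : (n : ℕ) ≠ e := fun h => h1 (PNat.eq h)
    have h2' : (n : ℕ) ≠ 2 * e := fun h => h2 (PNat.eq h)
    by_cases hi : i = 0 ∨ i = e
    · have hj0 : j ≠ 0 := by omega
      have hje : j ≠ e := by omega
      simp only [if_neg hj0, if_neg hje]
      rw [zero_pow (hp _), zero_mul]
    · rw [not_or] at hi
      rw [if_neg hi.1, if_neg hi.2, mul_zero]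

variable [CharP K p]

theorem power_conv_power_apply (e : ℕ+) (a b : ℕ) (f : MilnorDual p K) :
    (milnorElt p K (Finsupp.single e a) * milnorElt p K (Finsupp.single e b)).ofConv f =
      ((convHom p (lineRestrict p K e (C X : K[X][X])) (lineRestrict p K e (X : K[X][X]))
        f).coeff b).coeff a := by
  refine conv_apply_eq _ _ ((Polynomial.lcoeff K a) ∘ₗ
    (Polynomial.lcoeff K[X] b).restrictScalars K) _ _ (fun c d => ?_) f
  have h1 : lineRestrict p K e (C X : K[X][X]) c = C (lineRestrict p K e (X : K[X]) c) :=
    (lineRestrict_algHom p K e (Algebra.algHom K K[X] K[X][X]) X c).symm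
  have h2 : lineRestrict p K e (X : K[X][X]) d =
      mapAlgHom (Algebra.ofId K K[X]) (lineRestrict p K e (X : K[X]) d) := by
    rw [lineRestrict_algHom]
    simp
  rw [h1, h2, milnorElt_apply, milnorElt_apply, ← coeff_lineRestrict, ← coeff_lineRestrict]
  simp


/-- The value of a product of two Steenrod powers on a monomial in `ξ_e` and `ξ_{2e}`. -/
theorem power_conv_power_xiMonomial (e : ℕ+) (a b t u : ℕ) :
    (milnorElt p K (Finsupp.single e a) * milnorElt p K (Finsupp.single e b)).ofConv
      (xiMonomial p K (Finsupp.single e t + Finsupp.single (2 * e) u)) =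
      if u ≤ b ∧ p ^ (e : ℕ) * u ≤ a ∧ t + (p ^ (e : ℕ) + 1) * u = a + b then
        (t.choose (b - u) : K) else 0 := by
  have hne : 2 * e ≠ e := fun h => by
    have := congrArg PNat.val h
    have he := e.pos
    rw [PNat.mul_coe] at this
    simp at this
  rw [power_conv_power_apply, algHom_xiMonomial, Finsupp.prod_add_index' (by simp)
    (fun _ _ _ => pow_add _ _ _), Finsupp.prod_single_index (by simp),
    Finsupp.prod_single_index (by simp), lineRestrict_conv_xi, lineRestrict_conv_xi, if_pos rfl,
    if_neg hne, if_pos rfl, mul_pow, ← mul_assoc, coeff_mul_X_pow', ← C_pow]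
  by_cases hub : u ≤ b
  · rw [if_pos hub, coeff_mul_C, coeff_X_add_C_pow, mul_right_comm, ← pow_mul, ← pow_add,
      ← map_natCast (C (R := K)), coeff_mul_C, coeff_X_pow]
    by_cases hbt : b - u ≤ t
    · have : (p ^ (e : ℕ) + 1) * u = p ^ (e : ℕ) * u + u := by ring
      rw [ite_mul, one_mul, zero_mul]
      exact if_congr (by omega) rfl rfl
    · simp [Nat.choose_eq_zero_of_lt (not_le.1 hbt)]
  · rw [if_neg hub, if_neg (fun h => hub h.1), coeff_zero]

theorem power_conv_power_xiMonomial_eq_zero (e : ℕ+) (a b : ℕ) (T : ℕ+ →₀ ℕ)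
    (hT : ¬ ∃ t u, T = Finsupp.single e t + Finsupp.single (2 * e) u) :
    (milnorElt p K (Finsupp.single e a) * milnorElt p K (Finsupp.single e b)).ofConv
      (xiMonomial p K T) = 0 := by
  obtain ⟨n, hn, h1, h2⟩ : ∃ n ∈ T.support, n ≠ e ∧ n ≠ 2 * e := by
    by_contra! h
    refine hT ⟨T e, T (2 * e), ?_⟩
    have hne : e ≠ 2 * e := fun h => by
      have := congrArg PNat.val h
      have he := e.pos
      rw [PNat.mul_coe] at this
      simp at this
    ext n
    by_cases hn : n ∈ T.support
    · by_cases h1 : n = e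
      · subst h1
        simp
      · rw [h n hn h1]
        simp
    · have hn0 := Finsupp.notMem_support_iff.1 hn
      rw [hn0, Finsupp.add_apply, Finsupp.single_apply, Finsupp.single_apply]
      split_ifs with h3 h4 h4
      · exact absurd (h3.trans h4.symm) hne
      · simp [h3, hn0]
      · simp [h4, hn0]
      · rfl
  rw [power_conv_power_apply, algHom_xiMonomial, Finsupp.prod, Finset.prod_eq_zero hn]
  · simp
  · rw [lineRestrict_conv_xi, if_neg h1, if_neg h2, zero_pow (Finsupp.mem_support_iff.1 hn)]

variable {K} in
-- Substituting a = qu + a', b = u + b', j = u + j' reduces this to the case u = 0: the terms with j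
-- < u vanish, and the sign is unchanged because (-1)^(q+1) = 1. If qu > a, no j in the range
-- reaches u.
theorem sum_choose_mul_choose_shift (e : ℕ+) {q : ℕ} (hq : q = p ^ (e : ℕ)) {a b : ℕ}
    (hab : a < q * b) {t u : ℕ} (htu : t + (q + 1) * u = a + b) :
    ∑ j ∈ Finset.range (a / q + 1), (-1 : K) ^ (a + j) *
        (((q - 1) * (b - j) - 1).choose (a - q * j) : K) *
          (if u ≤ j ∧ q * u ≤ a + b - j then (t.choose (j - u) : K) else 0) =
      if u ≤ b ∧ q * u ≤ a then (t.choose (b - u) : K) else 0 := by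
  have hq0 : 0 < q := by rw [hq]; exact pow_pos (Fact.out : p.Prime).pos _
  have hsign : (-1 : K) ^ q = -1 := by
    rw [hq, ← zero_sub, sub_pow_char_pow, zero_pow (pow_ne_zero _ (Fact.out : p.Prime).ne_zero),
      one_pow]
  by_cases hua : q * u ≤ a
  · have hub : u < b := by
      by_contra! h
      exact absurd (Nat.mul_le_mul_left q h) (by omega)
    rw [if_pos ⟨hub.le, hua⟩]
    obtain ⟨a', rfl⟩ : ∃ a', a = q * u + a' := ⟨a - q * u, by omega⟩
    obtain ⟨b', rfl⟩ : ∃ b', b = u + b' := ⟨b - u, by omega⟩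
    have ht : t = a' + b' := by
      have : (q + 1) * u = q * u + u := by ring
      omega
    subst ht
    have hab' : a' < q * b' := by rw [Nat.mul_add] at hab; omega
    rw [Nat.mul_add_div hq0, add_assoc, Finset.sum_range_add, Finset.sum_eq_zero, zero_add,
      Nat.add_sub_cancel_left, Nat.choose_symm_add.symm, ← sum_choose_mul_choose p e e.pos hq hab']
    · refine Finset.sum_congr rfl fun j hj => ?_
      have hj' : j < b' := by
        have := Finset.mem_range.1 hj
        have := Nat.div_lt_of_lt_mul hab'
        omega
      rw [if_pos ⟨Nat.le_add_right u j, by omega⟩, Nat.add_sub_cancel_left, Nat.mul_add,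
        Nat.add_sub_add_left, Nat.add_sub_add_left]
      congr 2
      rw [show q * u + a' + (u + j) = (a' + j) + (q + 1) * u by ring, pow_add, pow_mul, pow_succ,
        hsign]
      simp
    · intro j hj
      rw [if_neg (fun h => by have := Finset.mem_range.1 hj; omega), mul_zero]
  · rw [if_neg (fun h => hua h.2)]
    refine Finset.sum_eq_zero fun j hj => ?_
    rw [if_neg, mul_zero]
    rintro ⟨h, -⟩
    have h1 : u ≤ a / q := by have := Finset.mem_range.1 hj; omega
    exact hua ((Nat.mul_le_mul_left q h1).trans (Nat.mul_div_le a q))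

/-- The elements `P_e(r)` of Milnor's algebra satisfy the Adem relations. -/
theorem adem_milnorElt (e : ℕ+) {q : ℕ} (hq : q = p ^ (e : ℕ)) (a b : ℕ) (hab : a < q * b) :
    milnorElt p K (Finsupp.single e a) * milnorElt p K (Finsupp.single e b) =
      ∑ j ∈ Finset.range (a / q + 1),
        ((-1 : K) ^ (a + j) * (((q - 1) * (b - j) - 1).choose (a - q * j) : K)) •
          (milnorElt p K (Finsupp.single e (a + b - j)) * milnorElt p K (Finsupp.single e j)) := by
  refine milnorAlg_ext fun T => ?_
  rw [WithConv.ofConv_sum, LinearMap.sum_apply]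
  simp only [WithConv.ofConv_smul, LinearMap.smul_apply, smul_eq_mul]
  have hlt : a / q < b := Nat.div_lt_of_lt_mul hab
  by_cases hT : ∃ t u, T = Finsupp.single e t + Finsupp.single (2 * e) u
  · obtain ⟨t, u, rfl⟩ := hT
    simp only [power_conv_power_xiMonomial, ← hq]
    by_cases htu : t + (q + 1) * u = a + b
    · simp only [htu, and_true]
      rw [← sum_choose_mul_choose_shift (K := K) p e hq hab htu]
      refine Finset.sum_congr rfl fun j hj => ?_
      have : a + b - j + j = a + b := by have := Finset.mem_range.1 hj; omega
      simp only [this, and_true]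
    · rw [if_neg (fun h => htu h.2.2), Finset.sum_eq_zero]
      intro j hj
      have := Finset.mem_range.1 hj
      rw [if_neg (fun h => htu (by omega)), mul_zero]
  · rw [power_conv_power_xiMonomial_eq_zero p K e _ _ T hT, Finset.sum_eq_zero]
    intro j _
    rw [power_conv_power_xiMonomial_eq_zero p K e _ _ T hT, mul_zero]

theorem milnorElt_zero : milnorElt p K 0 = 1 := by
  refine milnorAlg_ext fun T => ?_
  rw [milnorElt_apply_xiMonomial, LinearMap.convOne_apply]
  change _ = milnorCounit p K (xiMonomial p K T)
  rw [algHom_xiMonomial]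
  simp only [milnorCounit_xi, PNat.ne_zero, if_false]
  by_cases hT : T = 0
  · simp [hT]
  · obtain ⟨n, hn⟩ := Finsupp.support_nonempty_iff.2 hT
    rw [if_neg hT, Finsupp.prod, Finset.prod_eq_zero hn]
    exact zero_pow (Finsupp.mem_support_iff.1 hn)

/-- The homomorphism `ρ` from the algebra of Steenrod `q`th powers to Milnor's algebra. -/
def milnorHom (e : ℕ+) : SteenrodAlg K (p ^ (e : ℕ)) →ₐ[K] MilnorAlg p K :=
  RingQuot.liftAlgHom K ⟨FreeAlgebra.lift K fun r => milnorElt p K (Finsupp.single e r), by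
    intro x y h
    cases h with
    | zero => simp [milnorElt_zero]
    | adem a b h => simpa using adem_milnorElt p K e rfl a b h⟩

theorem milnorHom_power (e : ℕ+) (r : ℕ) : milnorHom p K e (power K (p ^ (e : ℕ)) r) =
    milnorEltStretch p K e (Finsupp.single 1 r) := by
  rw [milnorEltStretch_single, milnorHom, power, RingQuot.liftAlgHom_mkAlgHom_apply,
    FreeAlgebra.lift_ι_apply]

end Adem

/-- The degree of the sequence `R` for the grading in which `P^r` has degree `r`. -/
def degree (q : ℕ) (R : ℕ+ →₀ ℕ) : ℕ := R.sum fun k r => r * ∑ i ∈ Finset.range k, q ^ i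

/-! ### Admissible monomials span the Steenrod algebra -/

section Admissible

/-- The sequence with entries `i_k = r_k + q * i_(k+1)`. -/
def admSeq (q : ℕ) : List ℕ → List ℕ
  | [] => []
  | r :: rs => (r + q * (admSeq q rs).headD 0) :: admSeq q rs

theorem admSeq_append_zero (q : ℕ) (rs : List ℕ) : admSeq q (rs ++ [0]) = admSeq q rs ++ [0] := by
  induction rs with
  | nil => simp [admSeq]
  | cons r rs ih =>
    rw [List.cons_append, admSeq, ih, admSeq]
    cases admSeq q rs <;> simp

theorem headD_admSeq_append (q : ℕ) (rs : List ℕ) (r : ℕ) :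
    (admSeq q (rs ++ [r])).headD 0 = (admSeq q rs).headD 0 + q ^ rs.length * r := by
  induction rs with
  | nil => simp [admSeq]
  | cons s rs ih =>
    simp only [List.cons_append, admSeq, List.headD_cons, ih, List.length_cons]
    ring

/-- An entry r in position n + 1 contributes q^i r for 0 ≤ i ≤ n to the sequence. This is why
admissible monomials and Milnor elements with the same index have the same degree. -/
theorem sum_admSeq_append (q : ℕ) (rs : List ℕ) (r : ℕ) :
    (admSeq q (rs ++ [r])).sum =
      (admSeq q rs).sum + r * ∑ i ∈ Finset.range (rs.length + 1), q ^ i := by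
  induction rs with
  | nil => simp [admSeq]
  | cons s rs ih =>
    simp only [List.cons_append, admSeq, List.sum_cons, ih, List.length_cons, headD_admSeq_append]
    rw [Finset.sum_range_succ _ (rs.length + 1)]
    ring

theorem exists_admSeq_eq (q : ℕ) (l : List ℕ) (hl : l.IsChain fun a b => q * b ≤ a) :
    ∃ rs, admSeq q rs = l := by
  induction l with
  | nil => exact ⟨[], rfl⟩
  | cons a l ih =>
    obtain ⟨rs, hrs⟩ := ih hl.tail
    -- Admissibility makes this subtraction genuine; the default 0 serves the last entry, which is
    -- unconstrained.
    refine ⟨(a - q * l.headD 0) :: rs, ?_⟩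
    rw [admSeq, hrs]
    congr 1
    refine Nat.sub_add_cancel ?_
    cases l with
    | nil => simp
    | cons b l => exact (List.isChain_cons_cons.1 hl).1

/-- The list `R_1, …, R_n`. -/
def coordList (R : ℕ+ →₀ ℕ) (n : ℕ) : List ℕ := (List.range n).map fun k => R k.succPNat

theorem coordList_succ (R : ℕ+ →₀ ℕ) (n : ℕ) :
    coordList R (n + 1) = coordList R n ++ [R n.succPNat] := by
  simp [coordList, List.range_succ]

theorem exists_coordList_eq (rs : List ℕ) :
    ∃ R : ℕ+ →₀ ℕ, (∀ k : ℕ, rs.length ≤ k → R k.succPNat = 0) ∧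
      coordList R rs.length = rs := by
  classical
  refine ⟨rs.toFinsupp.mapDomain Nat.succPNat, fun k hk => ?_, ?_⟩
  · rw [Finsupp.mapDomain_apply Nat.succPNat_injective, List.toFinsupp_apply,
      List.getD_eq_default _ _ hk]
  · rw [coordList]
    simp only [Finsupp.mapDomain_apply Nat.succPNat_injective, List.toFinsupp_apply]
    exact List.ext_getElem (by simp) fun i h1 h2 => by simp [h2]

/-- The largest index of a nonzero entry of `R`. -/
def topIndex (R : ℕ+ →₀ ℕ) : ℕ := R.support.sup fun k => (k : ℕ)

theorem apply_eq_zero_of_topIndex_le {R : ℕ+ →₀ ℕ} {n : ℕ} (hn : topIndex R ≤ n) :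
    R n.succPNat = 0 := by
  by_contra h
  have := Finset.le_sup (f := fun k : ℕ+ => (k : ℕ)) (Finsupp.mem_support_iff.2 h)
  rw [Nat.succPNat_coe] at this
  unfold topIndex at hn
  omega

theorem topIndex_le {R : ℕ+ →₀ ℕ} {n : ℕ} (h : ∀ k : ℕ, n ≤ k → R k.succPNat = 0) :
    topIndex R ≤ n := by
  refine Finset.sup_le fun k hk => ?_
  by_contra! hlt
  refine Finsupp.mem_support_iff.1 hk ?_
  have hk' : k = (k.natPred).succPNat := by simp
  rw [hk']
  exact h _ (by rw [PNat.natPred]; omega)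

theorem sum_admSeq_coordList (q : ℕ) (R : ℕ+ →₀ ℕ) :
    (admSeq q (coordList R (topIndex R))).sum = degree q R := by
  have h : ∀ n, (admSeq q (coordList R n)).sum =
      ∑ k ∈ Finset.range n, R k.succPNat * ∑ i ∈ Finset.range (k + 1), q ^ i := by
    intro n
    induction n with
    | zero => simp [coordList, admSeq]
    | succ n ih =>
      rw [coordList_succ, sum_admSeq_append, ih, Finset.sum_range_succ _ n]
      simp [coordList]
  rw [h, degree, Finsupp.sum_of_support_subset R
    (s := (Finset.range (topIndex R)).image Nat.succPNat) _ _ (by simp),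
    Finset.sum_image (fun _ _ _ _ h => Nat.succPNat_injective h)]
  · simp
  · intro k hk
    refine Finset.mem_image.2 ⟨k.natPred, ?_, by simp⟩
    have := Finset.le_sup (f := fun k : ℕ+ => (k : ℕ)) hk
    have hk0 := k.pos
    rw [Finset.mem_range, PNat.natPred]
    unfold topIndex
    omega

/-- The moment of a list, with respect to which the Adem relations terminate. -/
def moment : List ℕ → ℕ
  | [] => 0
  | _ :: l => l.sum + moment l

theorem moment_append (u w : List ℕ) :
    moment (u ++ w) = moment u + u.length * w.sum + moment w := by
  induction u with
  | nil => simp [moment]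
  | cons a u ih =>
    simp only [List.cons_append, moment, ih, List.sum_append, List.length_cons]
    ring

theorem exists_of_not_isChain {q : ℕ} {l : List ℕ} (h : ¬ l.IsChain fun a b => q * b ≤ a) :
    ∃ u a b v, l = u ++ a :: b :: v ∧ a < q * b := by
  induction l with
  | nil => simp at h
  | cons a l ih =>
    cases l with
    | nil => simp at h
    | cons b l =>
      by_cases hab : q * b ≤ a
      · obtain ⟨u, a', b', v, h1, h2⟩ := ih fun h' => h (List.isChain_cons_cons.2 ⟨hab, h'⟩)
        exact ⟨a :: u, a', b', v, by rw [h1]; rfl, h2⟩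
      · exact ⟨[], a, b, l, rfl, not_le.1 hab⟩

variable (K : Type*) [Field K] (q : ℕ)

theorem power_zero : power K q 0 = 1 := by
  rw [power, RingQuot.mkAlgHom_rel K AdemRel.zero, map_one]

theorem power_mul_power (a b : ℕ) (h : a < q * b) :
    power K q a * power K q b = ∑ j ∈ Finset.range (a / q + 1),
      ((-1 : K) ^ (a + j) * (((q - 1) * (b - j) - 1).choose (a - q * j) : K)) •
        (power K q (a + b - j) * power K q j) := by
  have := RingQuot.mkAlgHom_rel K (AdemRel.adem (K := K) a b h)
  simp only [map_mul, map_sum, map_smul] at this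
  exact this

/-- The product of the Steenrod powers with exponents in the list `l`. -/
def powerProd (l : List ℕ) : SteenrodAlg K q := (l.map (power K q)).prod

theorem powerProd_append (u v : List ℕ) :
    powerProd K q (u ++ v) = powerProd K q u * powerProd K q v := by
  simp [powerProd]

theorem powerProd_cons (a : ℕ) (v : List ℕ) :
    powerProd K q (a :: v) = power K q a * powerProd K q v := by
  simp [powerProd]

/-- An Adem relation replaces neighbours (a, b) by (a + b - j, j) with j < b. This keeps the sum and
moves b - j one place to the left, so the moment drops by b - j and rewriting terminates. -/
theorem powerProd_mem_span_isChain (l : List ℕ) : powerProd K q l ∈ Submodule.span K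
    (powerProd K q '' {l' | l'.IsChain (fun a b => q * b ≤ a) ∧ l'.sum = l.sum}) := by
  induction hm : moment l using Nat.strong_induction_on generalizing l with
  | _ m ih =>
    subst hm
    by_cases hl : l.IsChain fun a b => q * b ≤ a
    · exact Submodule.subset_span ⟨l, ⟨hl, rfl⟩, rfl⟩
    · obtain ⟨u, a, b, v, rfl, hab⟩ := exists_of_not_isChain hl
      have hlt : a / q < b := Nat.div_lt_of_lt_mul hab
      have key : powerProd K q (u ++ a :: b :: v) = ∑ j ∈ Finset.range (a / q + 1),
          ((-1 : K) ^ (a + j) * (((q - 1) * (b - j) - 1).choose (a - q * j) : K)) •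
            powerProd K q (u ++ (a + b - j) :: j :: v) := by
        simp only [powerProd_append, powerProd_cons]
        rw [← mul_assoc (power K q a), power_mul_power K q a b hab, Finset.sum_mul, Finset.mul_sum]
        refine Finset.sum_congr rfl fun j _ => ?_
        rw [smul_mul_assoc, mul_smul_comm, mul_assoc]
      rw [key]
      refine Submodule.sum_mem _ fun j hj => Submodule.smul_mem _ _ ?_
      have hj' : j < b := by have := Finset.mem_range.1 hj; omega
      have hsum : (u ++ (a + b - j) :: j :: v).sum = (u ++ a :: b :: v).sum := by
        simp only [List.sum_append, List.sum_cons]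
        omega
      have := ih (moment (u ++ (a + b - j) :: j :: v)) (by
        rw [List.sum_append, List.sum_append, Nat.add_left_cancel_iff] at hsum
        rw [moment_append, moment_append, hsum]
        simp only [moment, List.sum_cons]
        omega) _ rfl
      rwa [hsum] at this

/-- The admissible monomial `P^{i_1} P^{i_2} ⋯` with `i_k - q i_(k+1) = R_k`. -/
def admMonomial (R : ℕ+ →₀ ℕ) : SteenrodAlg K q :=
  powerProd K q (admSeq q (coordList R (topIndex R)))

/-- Trailing zeros contribute factors P^0 = 1, so the cutoff is immaterial. -/
theorem powerProd_admSeq_coordList {R : ℕ+ →₀ ℕ} {n : ℕ} (hn : topIndex R ≤ n) :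
    powerProd K q (admSeq q (coordList R n)) = admMonomial K q R := by
  induction n, hn using Nat.le_induction with
  | base => rfl
  | succ n hn ih =>
    rw [coordList_succ, apply_eq_zero_of_topIndex_le hn, admSeq_append_zero, powerProd_append, ih,
      powerProd_cons, power_zero]
    simp [powerProd]

theorem powerProd_mem_span (l : List ℕ) : powerProd K q l ∈ Submodule.span K
    (admMonomial K q '' {R | degree q R = l.sum}) := by
  refine Submodule.span_mono ?_ (powerProd_mem_span_isChain K q l)
  rintro _ ⟨l', ⟨hl', hsum⟩, rfl⟩
  obtain ⟨rs, rfl⟩ := exists_admSeq_eq q l' hl'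
  obtain ⟨R, hR, hrs⟩ := exists_coordList_eq rs
  have hadm := powerProd_admSeq_coordList K q (topIndex_le hR)
  refine ⟨R, ?_, by rw [← hadm, hrs]⟩
  have hn := topIndex_le hR
  have hs : ∀ n, topIndex R ≤ n → (admSeq q (coordList R n)).sum = degree q R := by
    intro n hn
    induction n, hn using Nat.le_induction with
    | base => exact sum_admSeq_coordList q R
    | succ n hn ih =>
      rw [coordList_succ, apply_eq_zero_of_topIndex_le hn, sum_admSeq_append, ih, zero_mul,
        add_zero]
  change degree q R = _
  rw [← hsum, ← hs _ hn, hrs]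

theorem span_admMonomial : Submodule.span K (Set.range (admMonomial K q)) = ⊤ := by
  have h1 : Algebra.adjoin K (Set.range (power K q)) = ⊤ := by
    have : Set.range (power K q) =
        RingQuot.mkAlgHom K (AdemRel K q) '' Set.range (FreeAlgebra.ι K (X := ℕ)) := by
      rw [← Set.range_comp]; rfl
    rw [this, ← AlgHom.map_adjoin, FreeAlgebra.adjoin_range_ι, Algebra.map_top,
      AlgHom.range_eq_top]
    exact RingQuot.mkAlgHom_surjective K _
  have h2 := congrArg Subalgebra.toSubmodule h1
  rw [Algebra.adjoin_eq_span, Algebra.top_toSubmodule] at h2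
  rw [eq_top_iff, ← h2, Submodule.span_le]
  intro x hx
  obtain ⟨l, hl, rfl⟩ := Submonoid.exists_list_of_mem_closure hx
  obtain ⟨l', rfl⟩ : ∃ l' : List ℕ, l'.map (power K q) = l := by
    have : l ∈ Set.range (List.map (power K q)) := by
      rw [Set.range_list_map]; exact hl
    exact this
  exact Submodule.span_mono (Set.image_subset_range _ _) (powerProd_mem_span K q l')

end Admissible

/-! ### Base p digit sums, carries and the May weight -/

section DigitSum

variable (p : ℕ)

/-- The sum of the base `p` digits of `n`. -/
def digitSum (n : ℕ) : ℕ := (Nat.digits p n).sum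

theorem digitSum_zero : digitSum p 0 = 0 := by simp [digitSum]

theorem digitSum_le (n : ℕ) : digitSum p n ≤ n := Nat.digit_sum_le p n

/-- The sum of the digits of all the entries of `R`, those of `R_k` being counted `c k` times. -/
def digitWeight (c : ℕ+ → ℕ) (R : ℕ+ →₀ ℕ) : ℕ := R.sum fun k r => c k * digitSum p r

theorem digitWeight_zero (c : ℕ+ → ℕ) : digitWeight p c 0 = 0 := Finsupp.sum_zero_index

theorem digitWeight_single (c : ℕ+ → ℕ) (k : ℕ+) (r : ℕ) :
    digitWeight p c (Finsupp.single k r) = c k * digitSum p r :=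
  Finsupp.sum_single_index (by simp [digitSum_zero])

theorem digitWeight_eq_sum (c : ℕ+ → ℕ) {R : ℕ+ →₀ ℕ} {s : Finset ℕ+} (hs : R.support ⊆ s) :
    digitWeight p c R = ∑ k ∈ s, c k * digitSum p (R k) :=
  Finsupp.sum_of_support_subset R hs _ (by simp [digitSum_zero])

theorem digitWeight_add_of_digitSum_add (c : ℕ+ → ℕ) {R S : ℕ+ →₀ ℕ}
    (h : ∀ k, digitSum p (R k + S k) = digitSum p (R k) + digitSum p (S k)) :
    digitWeight p c (R + S) = digitWeight p c R + digitWeight p c S := by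
  classical
  rw [digitWeight_eq_sum p c (Finsupp.support_add (g₁ := R) (g₂ := S)),
    digitWeight_eq_sum p c (Finset.subset_union_left (s₁ := R.support) (s₂ := S.support)),
    digitWeight_eq_sum p c (Finset.subset_union_right (s₁ := R.support) (s₂ := S.support)),
    ← Finset.sum_add_distrib]
  exact Finset.sum_congr rfl fun k _ => by rw [Finsupp.add_apply, h, mul_add]

/-- The May weight of `R`. -/
abbrev weight (R : ℕ+ →₀ ℕ) : ℕ := digitWeight p (fun k => k) R

/-- The number of digits of `R`. -/
abbrev numDigits (R : ℕ+ →₀ ℕ) : ℕ := digitWeight p (fun _ => 1) R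

/-- Termwise k ≤ 1 + q + ⋯ + q^(k-1). The bound allows induction on decreasing weight within a fixed
degree. -/
theorem weight_le_degree {q : ℕ} (hq : 0 < q) (R : ℕ+ →₀ ℕ) : weight p R ≤ degree q R := by
  refine Finset.sum_le_sum fun k _ => ?_
  simp only
  rw [mul_comm]
  refine Nat.mul_le_mul (digitSum_le p _) ?_
  calc (k : ℕ) = ∑ i ∈ Finset.range k, 1 := by simp
    _ ≤ _ := Finset.sum_le_sum fun i _ => Nat.one_le_pow _ _ hq

variable [hp : Fact p.Prime]

/-- Kummer's theorem, from Legendre's formula for the three factorials. Equality s(a + b) = s(a) +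
s(b) thus means that there are no carries and that the binomial coefficient is prime to p. -/
theorem digitSum_add (a b : ℕ) :
    (p - 1) * padicValNat p ((a + b).choose a) + digitSum p (a + b) =
      digitSum p a + digitSum p b := by
  have h1 := sub_one_mul_padicValNat_factorial (p := p) (a + b)
  have h2 := sub_one_mul_padicValNat_factorial (p := p) a
  have h3 := sub_one_mul_padicValNat_factorial (p := p) b
  have h4 : padicValNat p (a + b).factorial =
      padicValNat p ((a + b).choose a) + padicValNat p a.factorial + padicValNat p b.factorial := by
    rw [← Nat.add_choose_mul_factorial_mul_factorial a b, padicValNat.mul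
      (mul_ne_zero (Nat.choose_ne_zero (by omega)) a.factorial_ne_zero) b.factorial_ne_zero,
      padicValNat.mul (Nat.choose_ne_zero (by omega)) a.factorial_ne_zero, Nat.choose_symm_add]
  rw [h4, Nat.mul_add, Nat.mul_add, h2, h3] at h1
  have := Nat.digit_sum_le p (a + b)
  have := Nat.digit_sum_le p a
  have := Nat.digit_sum_le p b
  unfold digitSum
  omega

theorem digitSum_add_le (a b : ℕ) : digitSum p (a + b) ≤ digitSum p a + digitSum p b := by
  rw [← digitSum_add]; omega

theorem not_dvd_choose_of_digitSum_add {a b : ℕ}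
    (h : digitSum p (a + b) = digitSum p a + digitSum p b) : ¬ p ∣ (a + b).choose a := by
  intro hd
  have h1 := digitSum_add p a b
  have h2 := one_le_padicValNat_of_dvd (Nat.choose_ne_zero (by omega)) hd
  have h3 := Nat.sub_pos_of_lt hp.out.one_lt
  have := Nat.mul_pos h3 h2
  omega

theorem digitSum_mul_add {r : ℕ} (hr : r < p) (n : ℕ) :
    digitSum p (p * n + r) = digitSum p n + r := by
  by_cases h : n = 0 ∧ r = 0
  · simp [h.1, h.2, digitSum]
  · rw [digitSum, add_comm, Nat.digits_add p hp.out.one_lt r n hr (by omega), List.sum_cons,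
      add_comm, digitSum]

theorem digitSum_pow (j : ℕ) : digitSum p (p ^ j) = 1 := by
  induction j with
  | zero =>
    have := digitSum_mul_add p hp.out.one_lt 0
    simpa [digitSum_zero] using this
  | succ j ih =>
    have := digitSum_mul_add p hp.out.pos (p ^ j)
    rwa [add_zero, add_zero, ← pow_succ', ih] at this

theorem exists_eq_pow_add {n : ℕ} (hn : n ≠ 0) :
    ∃ j m, n = p ^ j + m ∧ digitSum p n = 1 + digitSum p m := by
  induction n using Nat.strong_induction_on with
  | _ n ih =>
    have hlt := Nat.mod_lt n hp.out.pos
    have hn' := Nat.div_add_mod n p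
    by_cases hr : n % p = 0
    · have hd : n / p ≠ 0 := fun h => hn (by rw [← hn', h, hr]; simp)
      obtain ⟨j, m, h1, h2⟩ := ih (n / p) (Nat.div_lt_self (by omega) hp.out.one_lt) hd
      refine ⟨j + 1, p * m, ?_, ?_⟩
      · rw [pow_succ', ← mul_add, ← h1]
        omega
      · have h3 := digitSum_mul_add p hp.out.pos (n / p)
        have h4 := digitSum_mul_add p hp.out.pos m
        rw [add_zero, add_zero] at h3 h4
        rw [h4, ← h2, ← h3]
        congr 1
        omega
    · refine ⟨0, p * (n / p) + (n % p - 1), by rw [pow_zero]; omega, ?_⟩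
      rw [digitSum_mul_add p (by omega)]
      conv_lhs => rw [← hn', digitSum_mul_add p hlt]
      omega

theorem digitWeight_add_le (c : ℕ+ → ℕ) (R S : ℕ+ →₀ ℕ) :
    digitWeight p c (R + S) ≤ digitWeight p c R + digitWeight p c S := by
  classical
  rw [digitWeight_eq_sum p c (Finsupp.support_add (g₁ := R) (g₂ := S)),
    digitWeight_eq_sum p c (Finset.subset_union_left (s₁ := R.support) (s₂ := S.support)),
    digitWeight_eq_sum p c (Finset.subset_union_right (s₁ := R.support) (s₂ := S.support)),
    ← Finset.sum_add_distrib]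
  refine Finset.sum_le_sum fun k _ => ?_
  rw [Finsupp.add_apply, ← mul_add]
  exact Nat.mul_le_mul_left _ (digitSum_add_le p _ _)

/-- Digit sums are subadditive in each position and the multiplicities are positive, so equality of
the totals forces equality in every position. -/
theorem digitSum_add_of_digitWeight_add {c : ℕ+ → ℕ} (hc : ∀ k, 0 < c k) {R S : ℕ+ →₀ ℕ}
    (h : digitWeight p c (R + S) = digitWeight p c R + digitWeight p c S) (k : ℕ+) :
    digitSum p (R k + S k) = digitSum p (R k) + digitSum p (S k) := by
  classical
  rw [digitWeight_eq_sum p c (Finsupp.support_add (g₁ := R) (g₂ := S)),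
    digitWeight_eq_sum p c (Finset.subset_union_left (s₁ := R.support) (s₂ := S.support)),
    digitWeight_eq_sum p c (Finset.subset_union_right (s₁ := R.support) (s₂ := S.support)),
    ← Finset.sum_add_distrib, Finset.sum_eq_sum_iff_of_le] at h
  · by_cases hk : k ∈ R.support ∪ S.support
    · have := h k hk
      rw [Finsupp.add_apply, ← mul_add] at this
      exact Nat.eq_of_mul_eq_mul_left (hc k) this
    · rw [Finset.mem_union, not_or, Finsupp.notMem_support_iff, Finsupp.notMem_support_iff] at hk
      simp [hk.1, hk.2, digitSum_zero]
  · intro k _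
    rw [Finsupp.add_apply, ← mul_add]
    exact Nat.mul_le_mul_left _ (digitSum_add_le p _ _)

/-- Splits one digit off a multi-index without carries, so that weight and number of digits are
additive. The inductions over digits rest on this. -/
theorem exists_eq_single_add {T : ℕ+ →₀ ℕ} (hT : T ≠ 0) :
    ∃ k j S, T = Finsupp.single k (p ^ j) + S ∧
      ∀ l, digitSum p (Finsupp.single k (p ^ j) l + S l) =
        digitSum p (Finsupp.single k (p ^ j) l) + digitSum p (S l) := by
  obtain ⟨k, hk⟩ := Finsupp.support_nonempty_iff.2 hT
  obtain ⟨j, m, h1, h2⟩ := exists_eq_pow_add p (Finsupp.mem_support_iff.1 hk)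
  have hle : Finsupp.single k (p ^ j) ≤ T := by
    rw [Finsupp.single_le_iff]; omega
  refine ⟨k, j, T - Finsupp.single k (p ^ j), (add_tsub_cancel_of_le hle).symm, fun l => ?_⟩
  rw [Finsupp.tsub_apply]
  by_cases hl : l = k
  · subst hl
    rw [Finsupp.single_eq_same, digitSum_pow, h1, Nat.add_sub_cancel_left, ← h1, h2]
  · simp [Finsupp.single_eq_of_ne hl, digitSum_zero]

theorem digitWeight_single_pow (c : ℕ+ → ℕ) (k : ℕ+) (j : ℕ) :
    digitWeight p c (Finsupp.single k (p ^ j)) = c k := by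
  rw [digitWeight_single, digitSum_pow, mul_one]

theorem eq_zero_of_numDigits_eq_zero {R : ℕ+ →₀ ℕ} (h : numDigits p R = 0) : R = 0 := by
  by_contra hR
  obtain ⟨k, j, S, rfl, hS⟩ := exists_eq_single_add p hR
  rw [numDigits, digitWeight_add_of_digitSum_add p _ hS, digitWeight_single_pow] at h
  omega

theorem eq_zero_of_weight_eq_zero {R : ℕ+ →₀ ℕ} (h : weight p R = 0) : R = 0 := by
  by_contra hR
  obtain ⟨k, j, S, rfl, hS⟩ := exists_eq_single_add p hR
  rw [weight, digitWeight_add_of_digitSum_add p _ hS, digitWeight_single_pow] at h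
  have := k.pos
  omega

end DigitSum

theorem degree_zero (q : ℕ) : degree q 0 = 0 := Finsupp.sum_zero_index

theorem degree_add (q : ℕ) (R S : ℕ+ →₀ ℕ) : degree q (R + S) = degree q R + degree q S :=
  Finsupp.sum_add_index' (by simp) (fun _ _ _ => add_mul _ _ _)

theorem degree_single (q : ℕ) (k : ℕ+) (r : ℕ) :
    degree q (Finsupp.single k r) = r * ∑ i ∈ Finset.range k, q ^ i :=
  Finsupp.sum_single_index (by simp)

/-- The inequality k R_k ≤ degree bounds both the nonzero positions and the entries by d. -/
theorem finite_degree_eq {q : ℕ} (hq : 0 < q) (d : ℕ) :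
    {R : ℕ+ →₀ ℕ | degree q R = d}.Finite := by
  classical
  refine (Set.finite_Iic (Finsupp.indicator (Finset.Icc 1 d.succPNat) fun _ _ => d)).subset ?_
  intro R hR k
  have hk : R k * k ≤ d := by
    by_cases hk : k ∈ R.support
    · calc R k * k = R k * ∑ i ∈ Finset.range k, 1 := by simp
        _ ≤ R k * ∑ i ∈ Finset.range k, q ^ i :=
          Nat.mul_le_mul_left _ (Finset.sum_le_sum fun i _ => Nat.one_le_pow _ _ hq)
        _ ≤ degree q R := Finset.single_le_sum
            (f := fun k => R k * ∑ i ∈ Finset.range (k : ℕ), q ^ i) (fun _ _ => Nat.zero_le _) hk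
        _ = d := hR
    · simp [Finsupp.notMem_support_iff.1 hk]
  by_cases h0 : R k = 0
  · rw [h0]; exact Nat.zero_le _
  · have h1 : (k : ℕ) ≤ R k * k := Nat.le_mul_of_pos_left _ (Nat.pos_of_ne_zero h0)
    have h2 : R k ≤ R k * k := Nat.le_mul_of_pos_right _ k.pos
    rw [Finsupp.indicator_of_mem]
    · omega
    · rw [Finset.mem_Icc]
      refine ⟨one_le, ?_⟩
      rw [← PNat.coe_le_coe, Nat.succPNat_coe]
      omega

/-! ### Products of the elements P_e(R) as coefficients of a coproduct -/

section Stretch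

variable (p : ℕ) (K : Type*) [Field K]

theorem mul_coe_injective (e : ℕ+) : Function.Injective fun k : ℕ+ => k * e :=
  fun _ _ h => mul_right_cancel h

/-- Extend a sequence by `1` in position `0`. -/
def extendOne {M : Type*} [One M] (x : ℕ+ → M) : ℕ → M
  | 0 => 1
  | n + 1 => x n.succPNat

theorem extendOne_zero {M : Type*} [One M] (x : ℕ+ → M) : extendOne x 0 = 1 := rfl

theorem extendOne_coe {M : Type*} [One M] (x : ℕ+ → M) (n : ℕ+) : extendOne x n = x n := by
  obtain ⟨n, rfl⟩ : ∃ m, Nat.succPNat m = n := ⟨n.natPred, n.succPNat_natPred⟩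
  rfl

/-- The homomorphism with `ξ_{ke} ↦ x_k`, and `ξ_n ↦ 0` if `e` does not divide `n`. -/
def stretchHom (e : ℕ+) {M : Type*} [CommRing M] [Algebra K M] (x : ℕ+ → M) :
    MilnorDual p K →ₐ[K] M :=
  MvPolynomial.aeval (R := K) (Function.extend (fun k : ℕ+ => k * e) x 0)

variable {M : Type*} [CommRing M] [Algebra K M]

theorem stretchHom_xi_coe (e : ℕ+) (x : ℕ+ → M) (n : ℕ+) :
    stretchHom p K e x (xi p K n) = Function.extend (fun k : ℕ+ => k * e) x 0 n := by
  rw [xi_pnat]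
  exact MvPolynomial.aeval_X _ _

theorem stretchHom_xi_mul (e : ℕ+) (x : ℕ+ → M) (k : ℕ) :
    stretchHom p K e x (xi p K (k * e)) = extendOne x k := by
  rcases Nat.eq_zero_or_pos k with rfl | hk
  · simp [xi_zero, extendOne_zero]
  · lift k to ℕ+ using hk
    rw [← PNat.mul_coe, stretchHom_xi_coe, (mul_coe_injective e).extend_apply, extendOne_coe]

theorem stretchHom_xi_of_not_dvd (e : ℕ+) (x : ℕ+ → M) {n : ℕ} (hn : ¬ (e : ℕ) ∣ n) :
    stretchHom p K e x (xi p K n) = 0 := by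
  have h0 : 0 < n := Nat.pos_of_ne_zero (by rintro rfl; simp at hn)
  lift n to ℕ+ using h0
  rw [stretchHom_xi_coe, Function.extend_apply', Pi.zero_apply]
  rintro ⟨k, hk⟩
  refine hn ⟨k, ?_⟩
  have := congrArg PNat.val hk
  rw [PNat.mul_coe] at this
  rw [mul_comm]
  exact this.symm

theorem stretchHom_algHom {N : Type*} [CommRing N] [Algebra K N] (e : ℕ+) (x : ℕ+ → M)
    (φ : M →ₐ[K] N) (f : MilnorDual p K) :
    φ (stretchHom p K e x f) = stretchHom p K e (φ ∘ x) f := by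
  have : φ.comp (stretchHom p K e x) = stretchHom p K e (φ ∘ x) := by
    refine milnorDual_algHom_ext fun n => ?_
    rw [AlgHom.comp_apply]
    by_cases hn : (e : ℕ) ∣ n
    · obtain ⟨k, rfl⟩ := hn
      rw [mul_comm, stretchHom_xi_mul, stretchHom_xi_mul]
      cases k <;> simp [extendOne]
    · rw [stretchHom_xi_of_not_dvd _ _ _ _ hn, stretchHom_xi_of_not_dvd _ _ _ _ hn, map_zero]
  exact DFunLike.congr_fun this f

/-- The exponent sequence `R_e`, with `r_k` in position `k * e`. -/
abbrev stretch (e : ℕ+) (R : ℕ+ →₀ ℕ) : ℕ+ →₀ ℕ := R.mapDomain fun k => k * e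

theorem stretchHom_xiMonomial_stretch (e : ℕ+) (x : ℕ+ → M) (T : ℕ+ →₀ ℕ) :
    stretchHom p K e x (xiMonomial p K (stretch e T)) = T.prod fun k t => x k ^ t := by
  rw [algHom_xiMonomial, Finsupp.prod_mapDomain_index_inj (mul_coe_injective e)]
  simp only [PNat.mul_coe, stretchHom_xi_mul, extendOne_coe]

theorem exists_not_dvd {e : ℕ+} {T : ℕ+ →₀ ℕ} (hT : ∀ S, T ≠ stretch e S) :
    ∃ n ∈ T.support, ¬ (e : ℕ) ∣ n := by
  by_contra! h
  refine hT (T.comapDomain (fun k => k * e) (mul_coe_injective e).injOn) ?_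
  rw [stretch, Finsupp.mapDomain_comapDomain _ (mul_coe_injective e)]
  intro n hn
  obtain ⟨k, hk⟩ := h n hn
  have hk0 : 0 < k := Nat.pos_of_ne_zero (by rintro rfl; have := n.pos; omega)
  lift k to ℕ+ using hk0
  exact ⟨k, PNat.eq (by rw [hk, PNat.mul_coe, mul_comm])⟩

theorem coeff_stretchHom (e : ℕ+) (R : ℕ+ →₀ ℕ) (f : MilnorDual p K) :
    MvPolynomial.coeff R (stretchHom p K e (MvPolynomial.X (R := K)) f) =
      (milnorEltStretch p K e R).ofConv f := by
  have : (MvPolynomial.lcoeff K R : MvPolynomial ℕ+ K →ₗ[K] K) ∘ₗ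
      (stretchHom p K e (MvPolynomial.X (R := K))).toLinearMap =
      (milnorEltStretch p K e R).ofConv := by
    refine milnorDual_linearMap_ext fun T => ?_
    rw [milnorEltStretch, milnorElt_apply_xiMonomial]
    change MvPolynomial.coeff R (stretchHom p K e _ (xiMonomial p K T)) = _
    by_cases hT : ∃ S, T = stretch e S
    · obtain ⟨S, rfl⟩ := hT
      rw [stretchHom_xiMonomial_stretch, ← MvPolynomial.monic_monomial_eq,
        MvPolynomial.coeff_monomial]
      exact if_congr (Finsupp.mapDomain_injective (mul_coe_injective e)).eq_iff.symm rfl rfl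
    · rw [not_exists] at hT
      obtain ⟨n, hn, hd⟩ := exists_not_dvd hT
      rw [if_neg (hT R), algHom_xiMonomial, Finsupp.prod, Finset.prod_eq_zero hn,
        MvPolynomial.coeff_zero]
      rw [stretchHom_xi_of_not_dvd _ _ _ _ hd, zero_pow (Finsupp.mem_support_iff.1 hn)]
  exact LinearMap.congr_fun this f

theorem milnorEltStretch_apply_stretch (e : ℕ+) (R T : ℕ+ →₀ ℕ) :
    (milnorEltStretch p K e R).ofConv (xiMonomial p K (stretch e T)) = if T = R then 1 else 0 := by
  rw [milnorEltStretch, milnorElt_apply_xiMonomial]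
  exact if_congr (Finsupp.mapDomain_injective (mul_coe_injective e)).eq_iff rfl rfl

theorem milnorEltStretch_apply_of_ne (e : ℕ+) (R : ℕ+ →₀ ℕ) {T : ℕ+ →₀ ℕ}
    (hT : ∀ S, T ≠ stretch e S) : (milnorEltStretch p K e R).ofConv (xiMonomial p K T) = 0 := by
  rw [milnorEltStretch, milnorElt_apply_xiMonomial]
  exact if_neg (hT R)

/-- Realises a tensor product of two coefficient functionals as one coefficient in two disjoint sets
of variables, as `conv_apply_eq` requires. -/
theorem coeff_sumElim_rename_mul_rename {σ τ : Type*} (R : σ →₀ ℕ) (S : τ →₀ ℕ)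
    (a : MvPolynomial σ K) (b : MvPolynomial τ K) :
    MvPolynomial.coeff (Finsupp.sumElim R S)
      (MvPolynomial.rename Sum.inl a * MvPolynomial.rename Sum.inr b) =
      MvPolynomial.coeff R a * MvPolynomial.coeff S b := by
  classical
  induction a using MvPolynomial.induction_on' with
  | add a a' ha ha' => rw [map_add, add_mul, MvPolynomial.coeff_add, ha, ha',
      MvPolynomial.coeff_add, add_mul]
  | monomial A x =>
    induction b using MvPolynomial.induction_on' with
    | add b b' hb hb' => rw [map_add, mul_add, MvPolynomial.coeff_add, hb, hb',
        MvPolynomial.coeff_add, mul_add]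
    | monomial B y =>
      rw [MvPolynomial.rename_monomial, MvPolynomial.rename_monomial, MvPolynomial.monomial_mul,
        ← Finsupp.sumElim_eq_add, MvPolynomial.coeff_monomial, MvPolynomial.coeff_monomial,
        MvPolynomial.coeff_monomial]
      have : Finsupp.sumElim A B = Finsupp.sumElim R S ↔ A = R ∧ B = S :=
        ⟨fun h => ⟨Finsupp.ext fun i => DFunLike.congr_fun h (Sum.inl i),
          Finsupp.ext fun i => DFunLike.congr_fun h (Sum.inr i)⟩, fun h => by rw [h.1, h.2]⟩
      simp only [this]
      split_ifs <;> simp_all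

theorem exists_of_coeff_sumElim_mul_ne_zero {σ τ : Type*} {R : σ →₀ ℕ} {S : τ →₀ ℕ}
    {f g : MvPolynomial (σ ⊕ τ) K} (h : MvPolynomial.coeff (Finsupp.sumElim R S) (f * g) ≠ 0) :
    ∃ R₁ S₁ R₂ S₂, R = R₁ + R₂ ∧ S = S₁ + S₂ ∧ MvPolynomial.coeff (Finsupp.sumElim R₁ S₁) f ≠ 0 ∧
      MvPolynomial.coeff (Finsupp.sumElim R₂ S₂) g ≠ 0 := by
  classical
  rw [MvPolynomial.coeff_mul] at h
  obtain ⟨⟨d₁, d₂⟩, hd, hne⟩ := Finset.exists_ne_zero_of_sum_ne_zero h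
  rw [Finset.HasAntidiagonal.mem_antidiagonal] at hd
  obtain ⟨⟨R₁, S₁⟩, rfl⟩ : ∃ x : (σ →₀ ℕ) × (τ →₀ ℕ), Finsupp.sumElim x.1 x.2 = d₁ :=
    Finsupp.sumFinsuppEquivProdFinsupp.symm.surjective d₁
  obtain ⟨⟨R₂, S₂⟩, rfl⟩ : ∃ x : (σ →₀ ℕ) × (τ →₀ ℕ), Finsupp.sumElim x.1 x.2 = d₂ :=
    Finsupp.sumFinsuppEquivProdFinsupp.symm.surjective d₂
  refine ⟨R₁, S₁, R₂, S₂, ?_, ?_, left_ne_zero_of_mul hne, right_ne_zero_of_mul hne⟩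
  · exact Finsupp.ext fun i => (DFunLike.congr_fun hd (Sum.inl i)).symm
  · exact Finsupp.ext fun i => (DFunLike.congr_fun hd (Sum.inr i)).symm

variable (e : ℕ+)

/-- The coproduct of `∏ ξ_{ke} ^ T_k` modulo the `ξ_n` for which `e` does not divide `n`, as a
polynomial in the `ξ_{ke} ⊗ 1` and `1 ⊗ ξ_{ke}`. -/
def comulPoly (T : ℕ+ →₀ ℕ) : MvPolynomial (ℕ+ ⊕ ℕ+) K :=
  convHom p (stretchHom p K e fun k => MvPolynomial.X (R := K) (Sum.inl k))
    (stretchHom p K e fun k => MvPolynomial.X (R := K) (Sum.inr k)) (xiMonomial p K (stretch e T))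

/-- The coefficient of `P(T)` in `P(R) P(S)`. -/
def structConst (R S T : ℕ+ →₀ ℕ) : K :=
  MvPolynomial.coeff (Finsupp.sumElim R S) (comulPoly p K e T)

theorem comulPoly_zero : comulPoly p K e 0 = 1 := by
  rw [comulPoly, algHom_xiMonomial]
  simp

theorem comulPoly_add (S T : ℕ+ →₀ ℕ) :
    comulPoly p K e (S + T) = comulPoly p K e S * comulPoly p K e T := by
  simp only [comulPoly, algHom_xiMonomial]
  rw [stretch, Finsupp.mapDomain_add, Finsupp.prod_add_index' (by simp)
    (fun _ _ _ => pow_add _ _ _)]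

/-- Modulo the ξ_n with e ∤ n, only the splittings of ke into multiples of e remain. The result is
Milnor's coproduct with p replaced by q = p^e. -/
theorem convHom_stretchHom_xi_mul (x y : ℕ+ → M) (k : ℕ) :
    convHom p (stretchHom p K e x) (stretchHom p K e y) (xi p K (k * e)) =
      ∑ i ∈ Finset.HasAntidiagonal.antidiagonal k,
        extendOne x i.2 ^ (p ^ (e : ℕ)) ^ i.1 * extendOne y i.1 := by
  have he := e.pos
  rw [convHom_xi]
  symm
  refine Finset.sum_of_injOn (fun i => (i.1 * (e : ℕ), i.2 * (e : ℕ))) ?_ ?_ ?_ ?_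
  · rintro ⟨a, b⟩ - ⟨c, d⟩ - h
    simp only [Prod.mk.injEq] at h
    exact Prod.ext (Nat.eq_of_mul_eq_mul_right he h.1) (Nat.eq_of_mul_eq_mul_right he h.2)
  · rintro ⟨a, b⟩ h
    simp only [Finset.mem_coe, Finset.HasAntidiagonal.mem_antidiagonal] at h ⊢
    rw [← add_mul, h]
  · rintro ⟨a, b⟩ h h'
    rw [Finset.HasAntidiagonal.mem_antidiagonal] at h
    by_cases ha : (e : ℕ) ∣ a
    · obtain ⟨a, rfl⟩ := ha
      have hb : (e : ℕ) ∣ b := (Nat.dvd_add_right (Dvd.intro a rfl)).1 (h ▸ Dvd.intro_left k rfl)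
      obtain ⟨b, rfl⟩ := hb
      refine absurd ⟨(a, b), ?_, ?_⟩ h'
      · simp only [Finset.mem_coe, Finset.HasAntidiagonal.mem_antidiagonal]
        refine Nat.eq_of_mul_eq_mul_right he ?_
        rw [← h]
        ring
      · simp [mul_comm]
    · simp only [stretchHom_xi_of_not_dvd _ _ _ _ ha, mul_zero]
  · rintro ⟨a, b⟩ -
    simp only [stretchHom_xi_mul]
    rw [← pow_mul, mul_comm (e : ℕ)]

variable [Fact p.Prime]

theorem convHom_stretchHom_xi_of_not_dvd (x y : ℕ+ → M) {n : ℕ} (hn : ¬ (e : ℕ) ∣ n) :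
    convHom p (stretchHom p K e x) (stretchHom p K e y) (xi p K n) = 0 := by
  rw [convHom_xi]
  refine Finset.sum_eq_zero ?_
  rintro ⟨a, b⟩ h
  rw [Finset.HasAntidiagonal.mem_antidiagonal] at h
  by_cases ha : (e : ℕ) ∣ a
  · have hb : ¬ (e : ℕ) ∣ b := fun hb => hn (h ▸ dvd_add ha hb)
    simp only [stretchHom_xi_of_not_dvd _ _ _ _ hb]
    rw [zero_pow (pow_ne_zero _ (Fact.out : p.Prime).ne_zero), zero_mul]
  · simp only [stretchHom_xi_of_not_dvd _ _ _ _ ha, mul_zero]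

/-- `Finsupp.single`, with the index `0` allowed. -/
def singleNat : ℕ → ℕ → ℕ+ →₀ ℕ
  | 0, _ => 0
  | n + 1, a => Finsupp.single n.succPNat a

theorem singleNat_zero (a : ℕ) : singleNat 0 a = 0 := rfl

theorem singleNat_coe (k : ℕ+) (a : ℕ) : singleNat k a = Finsupp.single k a := by
  obtain ⟨k, rfl⟩ : ∃ m, Nat.succPNat m = k := ⟨k.natPred, k.succPNat_natPred⟩
  rfl

/-- Frobenius: the p^j-th power of the sum for ξ_{ke} is the sum of the p^j-th powers, so there are
only k + 1 monomials. -/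
theorem comulPoly_single_pow [CharP K p] (k : ℕ+) (j : ℕ) :
    comulPoly p K e (Finsupp.single k (p ^ j)) = ∑ i ∈ Finset.HasAntidiagonal.antidiagonal (k : ℕ),
      MvPolynomial.monomial (Finsupp.sumElim (singleNat i.2 ((p ^ (e : ℕ)) ^ i.1 * p ^ j))
        (singleNat i.1 (p ^ j))) (1 : K) := by
  rw [comulPoly, stretch, Finsupp.mapDomain_single, algHom_xiMonomial,
    Finsupp.prod_single_index (by simp), PNat.mul_coe, convHom_stretchHom_xi_mul,
    sum_pow_char_pow]
  refine Finset.sum_congr rfl ?_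
  rintro ⟨a, b⟩ -
  have h1 : ∀ n m, extendOne (fun k => MvPolynomial.X (R := K) (Sum.inl k : ℕ+ ⊕ ℕ+)) n ^ m =
      MvPolynomial.monomial (Finsupp.sumElim (singleNat n m) 0) (1 : K) := fun n m => by
    cases n <;> simp [extendOne, singleNat, MvPolynomial.X_pow_eq_monomial]
  have h2 : ∀ n m, extendOne (fun k => MvPolynomial.X (R := K) (Sum.inr k : ℕ+ ⊕ ℕ+)) n ^ m =
      MvPolynomial.monomial (Finsupp.sumElim 0 (singleNat n m)) (1 : K) := fun n m => by
    cases n <;> simp [extendOne, singleNat, MvPolynomial.X_pow_eq_monomial]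
  simp only
  rw [mul_pow, ← pow_mul, h1, h2, MvPolynomial.monomial_mul, ← Finsupp.sumElim_add, add_zero,
    zero_add, one_mul]

variable [CharP K p]

theorem milnorEltStretch_mul_apply (R S : ℕ+ →₀ ℕ) (f : MilnorDual p K) :
    (milnorEltStretch p K e R * milnorEltStretch p K e S).ofConv f =
      MvPolynomial.coeff (Finsupp.sumElim R S)
        (convHom p (stretchHom p K e fun k => MvPolynomial.X (R := K) (Sum.inl k : ℕ+ ⊕ ℕ+))
          (stretchHom p K e fun k => MvPolynomial.X (R := K) (Sum.inr k)) f) := by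
  refine conv_apply_eq _ _ (MvPolynomial.lcoeff K (Finsupp.sumElim R S)) _ _ (fun a b => ?_) f
  rw [← coeff_stretchHom, ← coeff_stretchHom, ← coeff_sumElim_rename_mul_rename,
    stretchHom_algHom, stretchHom_algHom, MvPolynomial.lcoeff_apply]
  congr 3 <;> congr 1 <;> ext k <;> simp

theorem milnorEltStretch_mul_apply_of_ne (R S : ℕ+ →₀ ℕ) {T : ℕ+ →₀ ℕ}
    (hT : ∀ S, T ≠ stretch e S) :
    (milnorEltStretch p K e R * milnorEltStretch p K e S).ofConv (xiMonomial p K T) = 0 := by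
  obtain ⟨n, hn, hd⟩ := exists_not_dvd hT
  rw [milnorEltStretch_mul_apply, algHom_xiMonomial, Finsupp.prod, Finset.prod_eq_zero hn,
    MvPolynomial.coeff_zero]
  rw [convHom_stretchHom_xi_of_not_dvd _ _ _ _ _ hd, zero_pow (Finsupp.mem_support_iff.1 hn)]

theorem milnorEltStretch_mul_eq_sum (R S : ℕ+ →₀ ℕ) (s : Finset (ℕ+ →₀ ℕ))
    (hs : ∀ T, structConst p K e R S T ≠ 0 → T ∈ s) :
    milnorEltStretch p K e R * milnorEltStretch p K e S =
      ∑ T ∈ s, structConst p K e R S T • milnorEltStretch p K e T := by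
  refine milnorAlg_ext fun T => ?_
  rw [WithConv.ofConv_sum, LinearMap.sum_apply]
  simp only [WithConv.ofConv_smul, LinearMap.smul_apply, smul_eq_mul]
  by_cases hT : ∃ S, T = stretch e S
  · obtain ⟨T, rfl⟩ := hT
    rw [milnorEltStretch_mul_apply]
    simp only [milnorEltStretch_apply_stretch, mul_ite, mul_one, mul_zero, Finset.sum_ite_eq]
    split_ifs with h
    · rfl
    · by_contra hne
      exact h (hs T hne)
  · rw [not_exists] at hT
    rw [milnorEltStretch_mul_apply_of_ne p K e R S hT, Finset.sum_eq_zero]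
    intro U _
    rw [milnorEltStretch_apply_of_ne p K e U hT, mul_zero]

end Stretch

/-! ### Which P(T) occur in P(R)P(S), and the coefficient of P(R + S) -/

section StructureConstants

variable (p : ℕ) (K : Type*) [Field K] (e : ℕ+)

theorem degree_singleNat (q n a : ℕ) :
    degree q (singleNat n a) = a * ∑ i ∈ Finset.range n, q ^ i := by
  cases n with
  | zero => simp [singleNat_zero, degree_zero]
  | succ n => simp [singleNat, degree_single]

theorem finsuppDegree_singleNat (n a : ℕ) :
    (singleNat n a).degree = if n = 0 then 0 else a := by
  cases n with
  | zero => simp [singleNat_zero]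
  | succ n => simp [singleNat]

theorem structConst_zero_right (R S : ℕ+ →₀ ℕ) (h : structConst p K e R S 0 ≠ 0) :
    R = 0 ∧ S = 0 := by
  classical
  rw [structConst, comulPoly_zero, MvPolynomial.coeff_one, ite_ne_right_iff] at h
  exact ⟨Finsupp.ext fun i => (DFunLike.congr_fun h.1 (Sum.inl i)).symm,
    Finsupp.ext fun i => (DFunLike.congr_fun h.1 (Sum.inr i)).symm⟩

variable [Fact p.Prime]

theorem weight_singleNat_pow (n i : ℕ) : weight p (singleNat n (p ^ i)) = n := by
  cases n with
  | zero => rw [singleNat_zero, weight, digitWeight_zero]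
  | succ n => rw [singleNat, weight, digitWeight_single_pow, Nat.succPNat_coe]

theorem numDigits_singleNat_pow (n i : ℕ) :
    numDigits p (singleNat n (p ^ i)) = if n = 0 then 0 else 1 := by
  cases n with
  | zero => rw [singleNat_zero, numDigits, digitWeight_zero, if_pos rfl]
  | succ n => rw [singleNat, numDigits, digitWeight_single_pow, if_neg n.succ_ne_zero]

variable [CharP K p]

theorem exists_of_structConst_single_pow_ne_zero {R S : ℕ+ →₀ ℕ} {k : ℕ+} {j : ℕ}
    (h : structConst p K e R S (Finsupp.single k (p ^ j)) ≠ 0) :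
    ∃ a b : ℕ, a + b = k ∧ R = singleNat b ((p ^ (e : ℕ)) ^ a * p ^ j) ∧
      S = singleNat a (p ^ j) := by
  classical
  rw [structConst, comulPoly_single_pow, MvPolynomial.coeff_sum] at h
  obtain ⟨⟨a, b⟩, hab, hne⟩ := Finset.exists_ne_zero_of_sum_ne_zero h
  rw [Finset.HasAntidiagonal.mem_antidiagonal] at hab
  rw [MvPolynomial.coeff_monomial, ite_ne_right_iff] at hne
  exact ⟨a, b, hab, Finsupp.ext fun i => (DFunLike.congr_fun hne.1 (Sum.inl i)).symm,
    Finsupp.ext fun i => (DFunLike.congr_fun hne.1 (Sum.inr i)).symm⟩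

/-- The multi-indices occurring in a product of Milnor basis elements: the product is homogeneous,
and it respects the weight; among the terms of lowest weight, `R + S` has the most digits. -/
theorem structConst_ne_zero {R S T : ℕ+ →₀ ℕ} (h : structConst p K e R S T ≠ 0) :
    degree (p ^ (e : ℕ)) R + degree (p ^ (e : ℕ)) S = degree (p ^ (e : ℕ)) T ∧
    T.degree ≤ R.degree + S.degree ∧
    weight p R + weight p S ≤ weight p T ∧
    (weight p R + weight p S = weight p T → numDigits p T ≤ numDigits p R + numDigits p S ∧
      (numDigits p T = numDigits p R + numDigits p S → R + S = T)) := by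
  induction hn : numDigits p T using Nat.strong_induction_on generalizing R S T with
  | _ n ih =>
    by_cases hT : T = 0
    · subst hT
      obtain ⟨rfl, rfl⟩ := structConst_zero_right p K e R S h
      subst hn
      simp [degree_zero, weight, numDigits, digitWeight_zero]
    · obtain ⟨k, j, T, rfl, hnc⟩ := exists_eq_single_add p hT
      have hw := digitWeight_add_of_digitSum_add p (fun k => k) hnc
      have hα := digitWeight_add_of_digitSum_add p (fun _ => 1) hnc
      rw [digitWeight_single_pow] at hw hα
      rw [structConst, comulPoly_add] at h
      -- The coproduct is multiplicative, so a nonzero coefficient comes from one monomial for the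
      -- split-off digit and one for the remaining T. The former is ξ_b^{q^a p^j} ⊗ ξ_a^{p^j} in
      -- units of e, with a + b = k, of total weight exactly k.
      obtain ⟨R₁, S₁, R₂, S₂, rfl, rfl, h1, h2⟩ := exists_of_coeff_sumElim_mul_ne_zero K h
      obtain ⟨a, b, hab, rfl, rfl⟩ := exists_of_structConst_single_pow_ne_zero p K e h1
      obtain ⟨ih1, ih2, ih3, ih4⟩ := ih (numDigits p T) (by unfold numDigits at hn ⊢; omega) h2 rfl
      have hpow : (p ^ (e : ℕ)) ^ a * p ^ j = p ^ (e * a + j) := by rw [pow_add, pow_mul]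
      have hk := k.pos
      have hj : 0 < p ^ j := pow_pos (Fact.out : p.Prime).pos _
      have hj' : p ^ j ≤ (p ^ (e : ℕ)) ^ a * p ^ j :=
        Nat.le_mul_of_pos_left _ (pow_pos (pow_pos (Fact.out : p.Prime).pos _) _)
      have hR := digitWeight_add_le p (fun k => k) (singleNat b ((p ^ (e : ℕ)) ^ a * p ^ j)) R₂
      have hS := digitWeight_add_le p (fun k => k) (singleNat a (p ^ j)) S₂
      have hwR : weight p (singleNat b ((p ^ (e : ℕ)) ^ a * p ^ j)) = b := by
        rw [hpow, weight_singleNat_pow]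
      have hwS := weight_singleNat_pow p a j
      have hαR : numDigits p (singleNat b ((p ^ (e : ℕ)) ^ a * p ^ j)) = if b = 0 then 0 else 1 := by
        rw [hpow, numDigits_singleNat_pow]
      have hαS := numDigits_singleNat_pow p a j
      refine ⟨?_, ?_, ?_, ?_⟩
      · rw [degree_add, degree_add, degree_add, ← ih1, degree_singleNat, degree_singleNat,
          degree_single, ← hab, Finset.sum_range_add]
        simp only [pow_add]
        rw [← Finset.mul_sum]
        ring
      · rw [map_add, map_add, map_add, finsuppDegree_singleNat, finsuppDegree_singleNat,
          Finsupp.degree_single]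
        split_ifs <;> omega
      · unfold weight at *
        omega
      -- Equality of weights excludes carries in both tensor factors, so their digit counts add up.
      -- A monomial with a and b both nonzero has two digits where T has one; equal counts therefore
      -- allow only ξ_k ⊗ 1 and 1 ⊗ ξ_k.
      · intro heq
        have hR' : weight p (singleNat b ((p ^ (e : ℕ)) ^ a * p ^ j) + R₂) =
            weight p (singleNat b ((p ^ (e : ℕ)) ^ a * p ^ j)) + weight p R₂ := by
          unfold weight at *; omega
        have hS' : weight p (singleNat a (p ^ j) + S₂) =
            weight p (singleNat a (p ^ j)) + weight p S₂ := by
          unfold weight at *; omega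
        have hT' : weight p R₂ + weight p S₂ = weight p T := by
          unfold weight at *; omega
        have hR'' := digitWeight_add_of_digitSum_add p (fun _ => 1)
          (digitSum_add_of_digitWeight_add p (fun k => k.pos) hR')
        have hS'' := digitWeight_add_of_digitSum_add p (fun _ => 1)
          (digitSum_add_of_digitWeight_add p (fun k => k.pos) hS')
        obtain ⟨ih5, ih6⟩ := ih4 hT'
        subst hn
        unfold numDigits at *
        rw [hα, hR'', hS'', hαR, hαS]
        by_cases hb : b = 0
        · subst hb
          obtain rfl : a = k := by omega
          rw [if_pos rfl, if_neg hk.ne']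
          refine ⟨by omega, fun h => ?_⟩
          rw [singleNat_zero, singleNat_coe, ← ih6 (by omega)]
          abel
        · rw [if_neg hb]
          by_cases ha : a = 0
          · subst ha
            obtain rfl : b = k := by omega
            rw [if_pos rfl]
            refine ⟨by omega, fun h => ?_⟩
            rw [singleNat_zero, singleNat_coe, ← ih6 (by omega), pow_zero, one_mul]
            abel
          · rw [if_neg ha]
            exact ⟨by omega, fun h => by omega⟩

/-- A mixed term of the coproduct of ξ_l has total exponent q^a + 1 instead of 1, and the total
exponent never drops in the remaining factor. As R + S has the same total as the target index, only
ξ_l ⊗ 1 and 1 ⊗ ξ_l contribute, which gives a Pascal recurrence. -/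
theorem structConst_add_single_one {R S T : ℕ+ →₀ ℕ} {l : ℕ+}
    (h : R + S = Finsupp.single l 1 + T) :
    structConst p K e R S (Finsupp.single l 1 + T) =
      (if R l = 0 then 0 else structConst p K e (R - Finsupp.single l 1) S T) +
      (if S l = 0 then 0 else structConst p K e R (S - Finsupp.single l 1) T) := by
  classical
  have hl := l.pos
  have hle : ∀ A B : ℕ+ →₀ ℕ, Finsupp.sumElim A B ≤ Finsupp.sumElim R S ↔ A ≤ R ∧ B ≤ S :=
    fun A B => ⟨fun h => ⟨fun i => h (Sum.inl i), fun i => h (Sum.inr i)⟩,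
      fun h i => by cases i; exacts [h.1 _, h.2 _]⟩
  have hsub : ∀ A B : ℕ+ →₀ ℕ, Finsupp.sumElim R S - Finsupp.sumElim A B =
      Finsupp.sumElim (R - A) (S - B) := fun A B => by
    ext i; cases i <;> rfl
  have h1 : comulPoly p K e (Finsupp.single l 1) = comulPoly p K e (Finsupp.single l (p ^ 0)) := by
    rw [pow_zero]
  rw [structConst, comulPoly_add, h1, comulPoly_single_pow, Finset.sum_mul,
    MvPolynomial.coeff_sum]
  simp only [MvPolynomial.coeff_monomial_mul', hle, hsub, one_mul, pow_zero, mul_one]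
  rw [Finset.sum_eq_add_of_mem (0, (l : ℕ)) ((l : ℕ), 0) (by simp) (by simp) (by simp)]
  · simp only [singleNat_zero, singleNat_coe, pow_zero, tsub_zero, zero_le, and_true, true_and,
      Finsupp.single_le_iff, Nat.one_le_iff_ne_zero, ite_not]
    rfl
  · rintro ⟨a, b⟩ hab ⟨h2, h3⟩
    simp only [Finset.HasAntidiagonal.mem_antidiagonal] at hab
    simp only [ne_eq, Prod.mk.injEq, not_and] at h2 h3
    have ha : a ≠ 0 := fun ha => h2 ha (by omega)
    have hb : b ≠ 0 := fun hb => h3 (by omega) hb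
    by_contra hne
    rw [ite_eq_right_iff, Classical.not_imp] at hne
    obtain ⟨⟨hR, hS⟩, hne⟩ := hne
    have hdeg := (structConst_ne_zero p K e hne).2.1
    have hR' := congrArg Finsupp.degree (add_tsub_cancel_of_le hR)
    have hS' := congrArg Finsupp.degree (add_tsub_cancel_of_le hS)
    have h' := congrArg Finsupp.degree h
    rw [map_add, finsuppDegree_singleNat, if_neg hb] at hR'
    rw [map_add, finsuppDegree_singleNat, if_neg ha] at hS'
    rw [map_add, map_add, Finsupp.degree_single] at h'
    have : 0 < (p ^ (e : ℕ)) ^ a := pow_pos (pow_pos (Fact.out : p.Prime).pos _) _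
    dsimp only at hR' hS' hdeg
    omega

/-- Units of S outside position k can be removed one at a time, since they can come only from the
right factor. What remains in position k is Pascal's rule. -/
theorem structConst_single_add (k : ℕ+) (a : ℕ) (S : ℕ+ →₀ ℕ) :
    structConst p K e (Finsupp.single k a) S (Finsupp.single k a + S) =
      ((a + S k).choose a : K) := by
  classical
  induction hn : (Finsupp.single k a + S).degree generalizing a S with
  | zero =>
    rw [Finsupp.degree_eq_zero_iff, add_eq_zero, Finsupp.single_eq_zero] at hn
    obtain ⟨rfl, rfl⟩ := hn
    simp [structConst, comulPoly_zero]
  | succ n ih =>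
    by_cases hS : ∃ l, l ≠ k ∧ S l ≠ 0
    · obtain ⟨l, hlk, hl⟩ := hS
      obtain ⟨S, rfl⟩ : ∃ S', S = Finsupp.single l 1 + S' :=
        ⟨_, (add_tsub_cancel_of_le (Finsupp.single_le_iff.2 (Nat.one_le_iff_ne_zero.2 hl))).symm⟩
      rw [add_left_comm] at hn ⊢
      rw [structConst_add_single_one p K e (by rw [add_left_comm]),
        if_pos (Finsupp.single_eq_of_ne hlk), if_neg hl, add_tsub_cancel_left, zero_add, ih]
      · rw [Finsupp.add_apply, Finsupp.single_eq_of_ne hlk.symm, zero_add]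
      · rw [map_add, Finsupp.degree_single] at hn
        omega
    · push Not at hS
      obtain ⟨s, rfl⟩ : ∃ s, S = Finsupp.single k s := ⟨S k, by
        ext l
        by_cases hl : l = k
        · simp [hl]
        · rw [hS l hl, Finsupp.single_eq_of_ne hl]⟩
      have hn' : a + s = n + 1 := by
        rwa [map_add, Finsupp.degree_single, Finsupp.degree_single] at hn
      have hT : Finsupp.single k a + Finsupp.single k s =
          Finsupp.single k 1 + Finsupp.single k n := by
        rw [← Finsupp.single_add, ← Finsupp.single_add, hn', add_comm]
      have ih' : ∀ a s, a + s = n →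
          structConst p K e (Finsupp.single k a) (Finsupp.single k s) (Finsupp.single k n) =
            (n.choose a : K) := fun a s has => by
        have := ih a (Finsupp.single k s) (by simp [has])
        rwa [← Finsupp.single_add, Finsupp.single_eq_same, has] at this
      rw [hT, structConst_add_single_one p K e hT]
      simp only [Finsupp.single_eq_same, ← Finsupp.single_tsub]
      rw [hn']
      cases a with
      | zero =>
        rw [if_pos rfl, if_neg (by omega), ih' 0 (s - 1) (by omega)]
        simp
      | succ a =>
        rw [if_neg a.succ_ne_zero, Nat.add_sub_cancel, ih' a s (by omega), Nat.choose_succ_succ]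
        cases s with
        | zero =>
          rw [if_pos rfl, Nat.choose_eq_zero_of_lt (by omega : n < a.succ)]
          simp
        | succ s =>
          rw [if_neg s.succ_ne_zero, Nat.add_sub_cancel, ih' (a + 1) s (by omega)]
          push_cast
          rfl

end StructureConstants

/-! ### Powers of the augmentation ideal -/

section AugmentationIdeal

variable {K : Type*} [Field K] {q : ℕ}

/-- The exponent n must be nonzero because `Ideal` means left ideal here: ⊤, the zeroth power, is in
general a unit for multiplication only from the left. -/
theorem mul_mem_augIdeal_pow {m n : ℕ} (hn : n ≠ 0) {x y : SteenrodAlg K q}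
    (hx : x ∈ augIdeal K q ^ m) (hy : y ∈ augIdeal K q ^ n) : x * y ∈ augIdeal K q ^ (m + n) := by
  rw [Submodule.pow_add _ hn]
  exact Ideal.mul_mem_mul hx hy

theorem mem_augIdeal_pow_zero (x : SteenrodAlg K q) : x ∈ augIdeal K q ^ 0 := by
  rw [Submodule.pow_zero, Ideal.one_eq_top]
  exact Submodule.mem_top

theorem augIdeal_pow_anti : Antitone fun m : ℕ => augIdeal K q ^ m := by
  refine antitone_nat_of_succ_le fun m => ?_
  rcases eq_or_ne m 0 with rfl | hm
  · exact fun x _ => mem_augIdeal_pow_zero x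
  · rw [Submodule.pow_succ' _ hm]
    exact Ideal.mul_le.2 fun r _ s hs => Ideal.mul_mem_left _ r hs

theorem power_mem_augIdeal {r : ℕ} (hr : r ≠ 0) : power K q r ∈ augIdeal K q := by
  rw [augIdeal, RingHom.mem_ker, power, augmentation]
  change RingQuot.liftAlgHom K _ (RingQuot.mkAlgHom K _ _) = 0
  rw [RingQuot.liftAlgHom_mkAlgHom_apply]
  simp [freeAugmentation, hr]

theorem steenrodAlg_algHom_ext {B : Type*} [Semiring B] [Algebra K B]
    {f g : SteenrodAlg K q →ₐ[K] B} (h : ∀ r, f (power K q r) = g (power K q r)) : f = g := by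
  refine RingQuot.ringQuot_ext' K f g (FreeAlgebra.hom_ext ?_)
  ext r
  exact h r

end AugmentationIdeal

/-! ### Every P_e(T) comes from the power of exponent w(T) -/

section Generation

variable (p : ℕ)

/-- Lexicographic induction: on the degree, then downwards on the weight, which the degree bounds,
then on the number of digits. -/
theorem multiIndex_induction {q : ℕ} (hq : 0 < q) {P : (ℕ+ →₀ ℕ) → Prop}
    (h : ∀ T, (∀ U, degree q U < degree q T → P U) →
      (∀ U, degree q U = degree q T → weight p T < weight p U → P U) →
      (∀ U, degree q U = degree q T → weight p U = weight p T →
        numDigits p U < numDigits p T → P U) → P T) (T : ℕ+ →₀ ℕ) : P T := by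
  induction hd : degree q T using Nat.strong_induction_on generalizing T with
  | _ d ih1 =>
    induction hw : d - weight p T using Nat.strong_induction_on generalizing T with
    | _ w ih2 =>
      induction hα : numDigits p T using Nat.strong_induction_on generalizing T with
      | _ α ih3 =>
        subst hd
        refine h T (fun U hU => ih1 _ hU U rfl) (fun U hU hlt => ?_) (fun U hU hw' hlt => ?_)
        · have := weight_le_degree p hq U
          exact ih2 (degree q T - weight p U) (by omega) U hU rfl
        · exact ih3 (numDigits p U) (hα ▸ hlt) U hU (by rw [hw', hw]) rfl

variable [Fact p.Prime] {K : Type*} [Field K] [CharP K p] (e : ℕ+)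

variable (K) in
theorem structConst_single_pow_comm {R' R'' : ℕ+ →₀ ℕ} {k l : ℕ+} {r s : ℕ}
    (hR' : R' = Finsupp.single k r) (hR'' : R'' = Finsupp.single l s) :
    structConst p K e R' R'' (R' + R'') = structConst p K e R'' R' (R' + R'') := by
  subst hR' hR''
  rw [structConst_single_add, add_comm (Finsupp.single k r), structConst_single_add]
  by_cases hkl : k = l
  · subst hkl
    rw [Finsupp.single_eq_same, Finsupp.single_eq_same, Nat.choose_symm_add, add_comm]
  · rw [Finsupp.single_eq_of_ne hkl, Finsupp.single_eq_of_ne (Ne.symm hkl)]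
    simp

theorem singleNat_eq_single_iff {n a b : ℕ} {k : ℕ+} (hb : b ≠ 0) :
    singleNat n a = Finsupp.single k b ↔ n = k ∧ a = b := by
  cases n with
  | zero =>
    have := k.pos
    rw [singleNat_zero, eq_comm, Finsupp.single_eq_zero]
    exact ⟨fun h => absurd h hb, fun h => by omega⟩
  | succ n =>
    rw [singleNat, Finsupp.single_eq_single_iff]
    constructor
    · rintro (⟨rfl, rfl⟩ | ⟨-, h⟩)
      · exact ⟨rfl, rfl⟩
      · exact absurd h hb
    · rintro ⟨h, rfl⟩
      exact Or.inl ⟨PNat.eq h, rfl⟩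

variable (K) in
-- The coefficient is that of the term ξ_k^{q p^j} ⊗ ξ_1^{p^j} in the coproduct of ξ_{k+1}^{p^j}, in
-- units of e.
theorem structConst_succ (k : ℕ+) (j : ℕ) :
    structConst p K e (Finsupp.single k (p ^ (e : ℕ) * p ^ j)) (Finsupp.single 1 (p ^ j))
      (Finsupp.single (k + 1) (p ^ j)) = 1 := by
  classical
  have hj : p ^ j ≠ 0 := pow_ne_zero _ (Fact.out : p.Prime).ne_zero
  have hsum : ∀ A B C D : ℕ+ →₀ ℕ, Finsupp.sumElim A B = Finsupp.sumElim C D ↔ A = C ∧ B = D :=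
    fun A B C D => ⟨fun h => ⟨Finsupp.ext fun i => DFunLike.congr_fun h (Sum.inl i),
      Finsupp.ext fun i => DFunLike.congr_fun h (Sum.inr i)⟩, fun h => by rw [h.1, h.2]⟩
  rw [structConst, comulPoly_single_pow, MvPolynomial.coeff_sum,
    Finset.sum_eq_single (1, (k : ℕ))]
  · rw [MvPolynomial.coeff_monomial, if_pos]
    rw [hsum]
    exact ⟨by rw [pow_one, singleNat_coe], singleNat_coe 1 _⟩
  · rintro ⟨a, b⟩ h hne
    rw [Finset.HasAntidiagonal.mem_antidiagonal, PNat.add_coe, PNat.one_coe] at h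
    rw [MvPolynomial.coeff_monomial, if_neg]
    rw [hsum]
    rintro ⟨-, h2⟩
    have := ((singleNat_eq_single_iff hj).1 h2).1
    rw [PNat.one_coe] at this
    simp only at h this
    exact hne (by rw [this]; congr 1; omega)
  · intro h
    exact absurd (by rw [Finset.HasAntidiagonal.mem_antidiagonal, PNat.add_coe, PNat.one_coe,
      add_comm]) h

variable (K) in
-- In the coproduct of ξ_{k+1}^{p^j} every nontrivial right tensor factor has exponent p^j, never q
-- p^j. The commutator therefore keeps the coefficient 1 of `structConst_succ`.
theorem structConst_succ_comm (k : ℕ+) (j : ℕ) :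
    structConst p K e (Finsupp.single 1 (p ^ j)) (Finsupp.single k (p ^ (e : ℕ) * p ^ j))
      (Finsupp.single (k + 1) (p ^ j)) = 0 := by
  have hp : p.Prime := Fact.out
  have hj : p ^ j ≠ 0 := pow_ne_zero _ hp.ne_zero
  by_contra h
  obtain ⟨a, b, hab, -, h2⟩ := exists_of_structConst_single_pow_ne_zero p K e h
  have h3 := ((singleNat_eq_single_iff (mul_ne_zero (pow_ne_zero _ hp.ne_zero) hj)).1 h2.symm).2
  have h4 : 1 < p ^ (e : ℕ) := Nat.one_lt_pow e.ne_zero hp.one_lt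
  have h5 : 1 * p ^ j < p ^ (e : ℕ) * p ^ j := Nat.mul_lt_mul_of_pos_right h4 (by omega)
  omega

theorem eq_single_pow_of_numDigits_eq_one {T : ℕ+ →₀ ℕ} (h : numDigits p T = 1) :
    ∃ k j, T = Finsupp.single k (p ^ j) := by
  have hT : T ≠ 0 := by
    rintro rfl
    rw [numDigits, digitWeight_zero] at h
    omega
  obtain ⟨k, j, S, rfl, hS⟩ := exists_eq_single_add p hT
  rw [numDigits, digitWeight_add_of_digitSum_add p _ hS, digitWeight_single_pow] at h
  have : S = 0 := eq_zero_of_numDigits_eq_zero p (by unfold numDigits; omega)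
  exact ⟨k, j, by rw [this, add_zero]⟩

variable (K) in
theorem milnorEltStretch_zero : milnorEltStretch p K e 0 = 1 := by
  rw [milnorEltStretch, Finsupp.mapDomain_zero, milnorElt_zero]

/-- The image in Milnor's algebra of the `m`th power of the augmentation ideal. -/
def augPowImage (ρ : SteenrodAlg K (p ^ (e : ℕ)) →ₐ[K] MilnorAlg p K) (m : ℕ) :
    Submodule K (MilnorAlg p K) :=
  ((augIdeal K (p ^ (e : ℕ)) ^ m).restrictScalars K).map ρ.toLinearMap

variable {p e} {ρ : SteenrodAlg K (p ^ (e : ℕ)) →ₐ[K] MilnorAlg p K}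

theorem augPowImage_anti : Antitone (augPowImage p e ρ) := fun _ _ h =>
  Submodule.map_mono (augIdeal_pow_anti h)

theorem mul_mem_augPowImage {m n : ℕ} (hn : n ≠ 0) {x y : MilnorAlg p K}
    (hx : x ∈ augPowImage p e ρ m) (hy : y ∈ augPowImage p e ρ n) :
    x * y ∈ augPowImage p e ρ (m + n) := by
  obtain ⟨x, hx, rfl⟩ := hx
  obtain ⟨y, hy, rfl⟩ := hy
  exact ⟨x * y, mul_mem_augIdeal_pow hn hx hy, map_mul ρ x y⟩

theorem mem_degreeFinset {q : ℕ} (hq : 0 < q) (d : ℕ) (T : ℕ+ →₀ ℕ) :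
    T ∈ (finite_degree_eq hq d).toFinset ↔ degree q T = d := by simp

/-- The Milnor basis element `P_e(T)` is the image of an element of the power of the augmentation
ideal whose exponent is the weight of `T`. -/
theorem milnorEltStretch_mem_augPowImage
    (hρ : ∀ r : ℕ, ρ (power K (p ^ (e : ℕ)) r) = milnorEltStretch p K e (Finsupp.single 1 r))
    (T : ℕ+ →₀ ℕ) : milnorEltStretch p K e T ∈ augPowImage p e ρ (weight p T) := by
  classical
  have hp : p.Prime := Fact.out
  have hq : 0 < p ^ (e : ℕ) := pow_pos hp.pos _
  induction T using multiIndex_induction p hq with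
  | h T ih1 ih2 ih3 =>
  by_cases hT : T = 0
  · subst hT
    refine ⟨1, ?_, ?_⟩
    · rw [weight, digitWeight_zero]
      exact mem_augIdeal_pow_zero _
    · rw [milnorEltStretch_zero]
      exact map_one ρ
  -- Error terms of larger weight, or of equal weight with fewer digits, are covered by the
  -- induction hypotheses.
  have hlow : ∀ U, degree (p ^ (e : ℕ)) U = degree (p ^ (e : ℕ)) T → weight p T ≤ weight p U →
      (weight p T = weight p U → numDigits p U < numDigits p T) →
      milnorEltStretch p K e U ∈ augPowImage p e ρ (weight p T) := by
    intro U hU hw hα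
    rcases hw.lt_or_eq with h | h
    · exact augPowImage_anti hw (ih2 U hU h)
    · exact augPowImage_anti hw (ih3 U hU h.symm (hα h))
  obtain ⟨k, j, S, rfl, hnc⟩ := exists_eq_single_add p hT
  set R := Finsupp.single k (p ^ j) with hR
  set T := R + S with hTdef
  set s := (finite_degree_eq hq (degree (p ^ (e : ℕ)) T)).toFinset with hs
  have hmems : ∀ U, U ∈ s ↔ degree (p ^ (e : ℕ)) U = degree (p ^ (e : ℕ)) T := fun U => by
    rw [hs]; exact mem_degreeFinset hq _ U
  have hTs : T ∈ s := (hmems T).2 rfl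
  have hw : weight p T = weight p R + weight p S := digitWeight_add_of_digitSum_add p _ hnc
  have hα : numDigits p T = numDigits p R + numDigits p S :=
    digitWeight_add_of_digitSum_add p _ hnc
  have hRw : weight p R = k := digitWeight_single_pow p _ k j
  have hRα : numDigits p R = 1 := digitWeight_single_pow p _ k j
  have hk := k.pos
  have hj0 : p ^ j ≠ 0 := pow_ne_zero _ hp.ne_zero
  have hd : degree (p ^ (e : ℕ)) T = degree (p ^ (e : ℕ)) R + degree (p ^ (e : ℕ)) S :=
    degree_add _ R S
  have hRd := weight_le_degree p hq R
  have hSd := weight_le_degree p hq S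
  by_cases hS : S = 0
  · have hTR : T = R := by rw [hTdef, hS, add_zero]
    rw [hTR] at hw hα hmems hTs hlow ih1 ⊢
    by_cases hk1 : k = 1
    · subst hk1
      refine ⟨power K (p ^ (e : ℕ)) (p ^ j), ?_, hρ _⟩
      rw [hRw, PNat.one_coe, Submodule.pow_one]
      exact power_mem_augIdeal hj0
    · obtain ⟨k, rfl⟩ : ∃ k', k = k' + 1 := ⟨k - 1, (PNat.sub_add_of_lt
        (lt_of_le_of_ne one_le (Ne.symm hk1))).symm⟩
      have hk' := k.pos
      set R' := Finsupp.single k (p ^ (e : ℕ) * p ^ j) with hR'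
      set R'' := Finsupp.single (1 : ℕ+) (p ^ j) with hR''
      have hw' : weight p R' = k := by
        rw [hR', ← pow_add, weight, digitWeight_single_pow]
      have hw'' : weight p R'' = 1 := digitWeight_single_pow p _ 1 j
      have hα' : numDigits p R' = 1 := by
        rw [hR', ← pow_add, numDigits, digitWeight_single_pow]
      have hα'' : numDigits p R'' = 1 := digitWeight_single_pow p _ 1 j
      have hdeg : degree (p ^ (e : ℕ)) R' + degree (p ^ (e : ℕ)) R'' = degree (p ^ (e : ℕ)) R := by
        have hgeom : ∑ i ∈ Finset.range (k + 1 : ℕ), (p ^ (e : ℕ)) ^ i =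
            (∑ i ∈ Finset.range (k : ℕ), (p ^ (e : ℕ)) ^ i) * p ^ (e : ℕ) + 1 := by
          rw [Finset.sum_range_succ', pow_zero, Finset.sum_mul]
          simp only [pow_succ]
        rw [hR', hR'', hR, degree_single, degree_single, degree_single, PNat.add_coe, PNat.one_coe,
          hgeom, Finset.sum_range_one, pow_zero]
        ring
      have hd' := weight_le_degree p hq R'
      have hd'' := weight_le_degree p hq R''
      have hRw' : weight p R = k + 1 := by rw [hRw, PNat.add_coe, PNat.one_coe]
      have hx' := ih1 R' (by omega)
      have hx'' := ih1 R'' (by omega)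
      have hmul1 := mul_mem_augPowImage (by omega) hx' hx''
      have hmul2 := mul_mem_augPowImage (by omega) hx'' hx'
      rw [hw', hw'', ← hRw'] at hmul1
      rw [hw', hw'', add_comm, ← hRw'] at hmul2
      rw [milnorEltStretch_mul_eq_sum p K e R' R'' s fun U hU => (hmems U).2
        (by rw [← (structConst_ne_zero p K e hU).1, hdeg])] at hmul1
      rw [milnorEltStretch_mul_eq_sum p K e R'' R' s fun U hU => (hmems U).2
        (by rw [← (structConst_ne_zero p K e hU).1, add_comm, hdeg])] at hmul2
      -- The commutator of P_e(R') and P_e(R'') lies in the required image, and P_e(R) has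
      -- coefficient 1 in it. It remains to see that its other terms are harmless.
      have hsub := Submodule.sub_mem _ hmul1 hmul2
      rw [← Finset.sum_sub_distrib] at hsub
      simp only [← sub_smul] at hsub
      rw [← Finset.add_sum_erase s _ hTs, hR', hR'', hR, structConst_succ, structConst_succ_comm,
        sub_zero, one_smul, ← hR, ← hR', ← hR''] at hsub
      refine (Submodule.add_mem_iff_left _ (Submodule.sum_mem _ fun U hU => ?_)).1 hsub
      obtain ⟨hUT, hUs⟩ := Finset.mem_erase.1 hU
      by_cases hc : structConst p K e R' R'' U - structConst p K e R'' R' U = 0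
      · rw [hc, zero_smul]
        exact Submodule.zero_mem _
      · refine Submodule.smul_mem _ _ (hlow U ((hmems U).1 hUs) ?_ ?_)
        · by_cases hc1 : structConst p K e R' R'' U = 0
          · rw [hc1, zero_sub, neg_eq_zero] at hc
            have := (structConst_ne_zero p K e hc).2.2.1
            omega
          · have := (structConst_ne_zero p K e hc1).2.2.1
            omega
        · intro hwU
          exfalso
          -- A term of lowest weight has at most two digits. With two digits it is R' + R'', whose
          -- coefficients in both orders agree and cancel; with one digit, weight and degree force
          -- it to be R.
          have hU2 : numDigits p U ≤ 2 ∧ (numDigits p U = 2 → R' + R'' = U) := by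
            by_cases hc1 : structConst p K e R' R'' U = 0
            · rw [hc1, zero_sub, neg_eq_zero] at hc
              have := (structConst_ne_zero p K e hc).2.2.2 (by omega)
              rw [add_comm R']
              exact ⟨by omega, fun h => this.2 (by omega)⟩
            · have := (structConst_ne_zero p K e hc1).2.2.2 (by omega)
              exact ⟨by omega, fun h => this.2 (by omega)⟩
          have hU0 : numDigits p U ≠ 0 := fun h => by
            rw [eq_zero_of_numDigits_eq_zero p h] at hwU
            rw [hRw', weight, digitWeight_zero] at hwU
            omega
          have hU2' : numDigits p U ≠ 2 := fun h => hc (by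
            rw [← hU2.2 h, structConst_single_pow_comm p K e hR' hR'', sub_self])
          obtain ⟨l, i, rfl⟩ := eq_single_pow_of_numDigits_eq_one p
            (by omega : numDigits p U = 1)
          rw [hRw, weight, digitWeight_single_pow] at hwU
          obtain rfl : k + 1 = l := PNat.eq hwU
          have hdU := (hmems _).1 hUs
          rw [hR, degree_single, degree_single] at hdU
          refine hUT ?_
          rw [hR, Nat.eq_of_mul_eq_mul_right ?_ hdU]
          exact Finset.sum_pos (fun _ _ => pow_pos hq _) ⟨0, Finset.mem_range.2 hk⟩
  · have hSw : weight p S ≠ 0 := fun h => hS (eq_zero_of_weight_eq_zero p h)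
    have hxR := ih1 R (by omega)
    have hxS := ih1 S (by omega)
    have hmul := mul_mem_augPowImage hSw hxR hxS
    rw [← hw, milnorEltStretch_mul_eq_sum p K e R S s fun U hU => (hmems U).2
      (by rw [← (structConst_ne_zero p K e hU).1, hd]), ← Finset.add_sum_erase s _ hTs] at hmul
    rw [Submodule.add_mem_iff_left _ (Submodule.sum_mem _ fun U hU => ?_)] at hmul
    -- Without carries the binomial coefficient at T = R + S is prime to p, so P_e(T) can be solved
    -- for.
    · have hc : structConst p K e R S T ≠ 0 := by
        rw [hTdef, hR, structConst_single_add, Ne, CharP.cast_eq_zero_iff K p]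
        have := hnc k
        rw [hR, Finsupp.single_eq_same] at this
        exact not_dvd_choose_of_digitSum_add p this
      exact (Submodule.smul_mem_iff _ hc).1 hmul
    · obtain ⟨hUT, hUs⟩ := Finset.mem_erase.1 hU
      by_cases hc : structConst p K e R S U = 0
      · rw [hc, zero_smul]
        exact Submodule.zero_mem _
      · obtain ⟨-, -, h3, h4⟩ := structConst_ne_zero p K e hc
        refine Submodule.smul_mem _ _ (hlow U ((hmems U).1 hUs) (by omega) fun h => ?_)
        obtain ⟨h5, h6⟩ := h4 (by omega)
        rcases h5.lt_or_eq with h7 | h7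
        · omega
        · exact absurd (h6 h7).symm hUT

end Generation

/-! ### Linear independence by dimension count in each degree -/

section GradedIndependence

variable {K : Type*} [Field K] {ι W : Type*} [AddCommGroup W] [Module K W]

/-- A surjective endomorphism of a free module that preserves a grading of the basis with finite
fibres is injective. -/
theorem injective_of_surjective_of_graded (deg : ι → ℕ) (hfin : ∀ d, {i | deg i = d}.Finite)
    (M : (ι →₀ K) →ₗ[K] (ι →₀ K))
    (hM : ∀ i, M (Finsupp.single i 1) ∈ Finsupp.supported K K {j | deg j = deg i})
    (hsurj : Function.Surjective M) : Function.Injective M := by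
  classical
  rw [← LinearMap.ker_eq_bot, LinearMap.ker_eq_bot']
  intro v hv
  have hπ : ∀ d, Finsupp.restrictDom K K {j | deg j = d} v = 0 := by
    intro d
    set s : Set ι := {j | deg j = d} with hs
    let π := Finsupp.restrictDom K K s
    -- The degree d block of M. As M preserves the degree it commutes with the projection, so the
    -- block is again surjective, and injective since it acts on a finite-dimensional space.
    let N : Finsupp.supported K K s →ₗ[K] Finsupp.supported K K s :=
      (π ∘ₗ M) ∘ₗ (Finsupp.supported K K s).subtype
    have hcomm : π ∘ₗ M = N ∘ₗ π := by
      refine Finsupp.lhom_ext' fun i => LinearMap.ext_ring ?_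
      change π (M (Finsupp.single i 1)) = π (M (π (Finsupp.single i 1) : ι →₀ K))
      by_cases hi : deg i = d
      · rw [Finsupp.restrictDom_apply, Finsupp.filter_single_of_pos _ (by exact hi)]
      · have h1 : ((π (Finsupp.single i 1) : Finsupp.supported K K s) : ι →₀ K) = 0 := by
          rw [Finsupp.restrictDom_apply, Finsupp.filter_single_of_neg _ (by exact hi)]
        rw [h1, map_zero, map_zero]
        refine Subtype.ext ?_
        rw [Finsupp.restrictDom_apply, ZeroMemClass.coe_zero, Finsupp.filter_eq_zero_iff]
        intro j hj
        by_contra hne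
        have := (Finsupp.mem_supported _ _).1 (hM i) (Finsupp.mem_support_iff.2 hne)
        exact hi (this.symm.trans hj)
    have hπs : Function.Surjective π := fun x =>
      ⟨x, LinearMap.congr_fun (Finsupp.restrictDom_comp_subtype s) x⟩
    have : Finite s := hfin d
    have : FiniteDimensional K (Finsupp.supported K K s) :=
      LinearEquiv.finiteDimensional (Finsupp.supportedEquivFinsupp s).symm
    have hN : Function.Injective N := by
      refine (LinearMap.injective_iff_surjective (K := K) (V := Finsupp.supported K K s) (f := N)).2 ?_
      refine Function.Surjective.of_comp (g := π) ?_
      have : (N ∘ π) = π ∘ M := by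
        funext x
        exact (LinearMap.congr_fun hcomm x).symm
      rw [this]
      exact hπs.comp hsurj
    refine hN ?_
    rw [map_zero]
    have := LinearMap.congr_fun hcomm v
    rw [LinearMap.comp_apply, hv, map_zero] at this
    exact this.symm
  ext i
  have := congrArg (fun x : Finsupp.supported K K {j | deg j = deg i} => (x : ι →₀ K) i) (hπ (deg i))
  simp only [Finsupp.restrictDom_apply, ZeroMemClass.coe_zero, Finsupp.zero_apply] at this
  rwa [Finsupp.filter_apply_pos _ _ (by rfl)] at this

/-- Expressing v in terms of u gives a degree-preserving endomorphism of the free module on the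
index set. It is surjective because v spans every u, hence injective since each degree has finitely
many indices. -/
theorem linearIndependent_of_graded (deg : ι → ℕ) (hfin : ∀ d, {i | deg i = d}.Finite)
    {u v : ι → W} (hu : LinearIndependent K u)
    (hvu : ∀ i, v i ∈ Submodule.span K (u '' {j | deg j = deg i}))
    (huv : ∀ i, u i ∈ Submodule.span K (Set.range v)) : LinearIndependent K v := by
  simp only [Finsupp.mem_span_image_iff_linearCombination] at hvu
  choose m hm hmv using hvu
  have hcomp : Finsupp.linearCombination K u ∘ₗ Finsupp.linearCombination K m =
      Finsupp.linearCombination K v := by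
    refine Finsupp.lhom_ext' fun i => LinearMap.ext_ring ?_
    simp [hmv]
  have hinj : Function.Injective (Finsupp.linearCombination K m) := by
    refine injective_of_surjective_of_graded deg hfin _ (fun i => by simpa using hm i) ?_
    intro y
    induction y using Finsupp.induction_linear with
    | zero => exact ⟨0, map_zero _⟩
    | add x y hx hy =>
      obtain ⟨x, rfl⟩ := hx
      obtain ⟨y, rfl⟩ := hy
      exact ⟨x + y, map_add _ x y⟩
    | single i a =>
      have := huv i
      rw [← Finsupp.range_linearCombination, ← hcomp] at this
      obtain ⟨c, hc⟩ := this
      refine ⟨a • c, ?_⟩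
      rw [map_smul, ← mul_one a, ← smul_eq_mul, ← Finsupp.smul_single, smul_eq_mul, mul_one]
      congr 1
      exact hu (by rw [Finsupp.linearCombination_single, one_smul]; exact hc)
  unfold LinearIndependent
  rw [← hcomp, LinearMap.coe_comp]
  exact Function.Injective.comp hu hinj

end GradedIndependence

/-! ### Injectivity of the homomorphism and the Milnor basis -/

section MilnorBasis

variable {p : ℕ} {K : Type*} [Field K] {e : ℕ+}

theorem linearCombination_milnorEltStretch_apply (c : (ℕ+ →₀ ℕ) →₀ K) (T : ℕ+ →₀ ℕ) :
    (Finsupp.linearCombination K (milnorEltStretch p K e) c).ofConv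
      (xiMonomial p K (stretch e T)) = c T := by
  rw [Finsupp.linearCombination_apply, Finsupp.sum, WithConv.ofConv_sum, LinearMap.sum_apply]
  simp only [WithConv.ofConv_smul, LinearMap.smul_apply, smul_eq_mul,
    milnorEltStretch_apply_stretch, mul_ite, mul_one, mul_zero, Finset.sum_ite_eq]
  split_ifs with h
  · rfl
  · exact (Finsupp.notMem_support_iff.1 h).symm

variable (p K e) in
theorem linearIndependent_milnorEltStretch : LinearIndependent K (milnorEltStretch p K e) := by
  intro c d h
  ext T
  rw [← linearCombination_milnorEltStretch_apply (p := p) (e := e) c, h,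
    linearCombination_milnorEltStretch_apply]

variable [Fact p.Prime] [CharP K p]

variable (p K e) in
/-- The span of the `P_e(R)` of degree `d`. -/
def degreeSpan (d : ℕ) : Submodule K (MilnorAlg p K) :=
  Submodule.span K (milnorEltStretch p K e '' {R | degree (p ^ (e : ℕ)) R = d})

theorem mul_mem_degreeSpan {c d : ℕ} {x y : MilnorAlg p K} (hx : x ∈ degreeSpan p K e c)
    (hy : y ∈ degreeSpan p K e d) : x * y ∈ degreeSpan p K e (c + d) := by
  have hq : 0 < p ^ (e : ℕ) := pow_pos (Fact.out : p.Prime).pos _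
  induction hx using Submodule.span_induction with
  | zero => rw [zero_mul]; exact Submodule.zero_mem _
  | add x x' _ _ hx hx' => rw [add_mul]; exact Submodule.add_mem _ hx hx'
  | smul a x _ hx => rw [smul_mul_assoc]; exact Submodule.smul_mem _ _ hx
  | mem x hx =>
    obtain ⟨R, rfl, rfl⟩ := hx
    induction hy using Submodule.span_induction with
    | zero => rw [mul_zero]; exact Submodule.zero_mem _
    | add y y' _ _ hy hy' => rw [mul_add]; exact Submodule.add_mem _ hy hy'
    | smul a y _ hy => rw [mul_smul_comm]; exact Submodule.smul_mem _ _ hy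
    | mem y hy =>
      obtain ⟨S, rfl, rfl⟩ := hy
      rw [milnorEltStretch_mul_eq_sum p K e R S (finite_degree_eq hq
        (degree (p ^ (e : ℕ)) R + degree (p ^ (e : ℕ)) S)).toFinset fun T hT =>
          (mem_degreeFinset hq _ T).2 (structConst_ne_zero p K e hT).1.symm]
      exact Submodule.sum_mem _ fun T hT => Submodule.smul_mem _ _
        (Submodule.subset_span ⟨T, (mem_degreeFinset hq _ T).1 hT, rfl⟩)

variable {ρ : SteenrodAlg K (p ^ (e : ℕ)) →ₐ[K] MilnorAlg p K}

theorem map_powerProd_mem_degreeSpan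
    (hρ : ∀ r : ℕ, ρ (power K (p ^ (e : ℕ)) r) = milnorEltStretch p K e (Finsupp.single 1 r))
    (l : List ℕ) : ρ (powerProd K (p ^ (e : ℕ)) l) ∈ degreeSpan p K e l.sum := by
  induction l with
  | nil =>
    refine Submodule.subset_span ⟨0, degree_zero _, ?_⟩
    rw [milnorEltStretch_zero]
    exact (map_one ρ).symm
  | cons a l ih =>
    rw [powerProd_cons, map_mul, List.sum_cons, hρ]
    refine mul_mem_degreeSpan (Submodule.subset_span ⟨_, ?_, rfl⟩) ih
    change degree _ _ = a
    simp [degree_single]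

theorem map_admMonomial_mem_degreeSpan
    (hρ : ∀ r : ℕ, ρ (power K (p ^ (e : ℕ)) r) = milnorEltStretch p K e (Finsupp.single 1 r))
    (R : ℕ+ →₀ ℕ) :
    ρ (admMonomial K (p ^ (e : ℕ)) R) ∈ degreeSpan p K e (degree (p ^ (e : ℕ)) R) := by
  rw [← sum_admSeq_coordList]
  exact map_powerProd_mem_degreeSpan hρ _

theorem exists_map_eq_milnorEltStretch
    (hρ : ∀ r : ℕ, ρ (power K (p ^ (e : ℕ)) r) = milnorEltStretch p K e (Finsupp.single 1 r))
    (T : ℕ+ →₀ ℕ) :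
    ∃ x ∈ augIdeal K (p ^ (e : ℕ)) ^ weight p T, ρ x = milnorEltStretch p K e T :=
  milnorEltStretch_mem_augPowImage hρ T

/-- The images of the admissible monomials span all P_e(T), and both families are indexed by the
same R with the same degrees. The images are therefore independent; since the admissible monomials
span the source, no nonzero element is killed. -/
theorem injective_of_map_power
    (hρ : ∀ r : ℕ, ρ (power K (p ^ (e : ℕ)) r) = milnorEltStretch p K e (Finsupp.single 1 r)) :
    Function.Injective ρ := by
  have hq : 0 < p ^ (e : ℕ) := pow_pos (Fact.out : p.Prime).pos _
  have hcomp : ∀ c, ρ (Finsupp.linearCombination K (admMonomial K (p ^ (e : ℕ))) c) =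
      Finsupp.linearCombination K (ρ ∘ admMonomial K (p ^ (e : ℕ))) c := fun c =>
    Finsupp.apply_linearCombination K ρ.toLinearMap (admMonomial K (p ^ (e : ℕ))) c
  have hsurj : ∀ x, ∃ c, Finsupp.linearCombination K (admMonomial K (p ^ (e : ℕ))) c = x := by
    intro x
    have hx : x ∈ Submodule.span K (Set.range (admMonomial K (p ^ (e : ℕ)))) := by
      rw [span_admMonomial]; exact Submodule.mem_top
    rwa [← Finsupp.range_linearCombination] at hx
  have hli : LinearIndependent K (ρ ∘ admMonomial K (p ^ (e : ℕ))) := by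
    refine linearIndependent_of_graded (degree (p ^ (e : ℕ))) (finite_degree_eq hq)
      (linearIndependent_milnorEltStretch p K e) (map_admMonomial_mem_degreeSpan hρ) fun T => ?_
    obtain ⟨x, -, hx⟩ := exists_map_eq_milnorEltStretch hρ T
    obtain ⟨c, rfl⟩ := hsurj x
    rw [← hx, hcomp, ← Finsupp.range_linearCombination]
    exact ⟨c, rfl⟩
  intro x y hxy
  obtain ⟨c, rfl⟩ := hsurj x
  obtain ⟨d, rfl⟩ := hsurj y
  rw [hcomp, hcomp] at hxy
  rw [hli hxy]

theorem map_mem_span_milnorEltStretch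
    (hρ : ∀ r : ℕ, ρ (power K (p ^ (e : ℕ)) r) = milnorEltStretch p K e (Finsupp.single 1 r))
    (x : SteenrodAlg K (p ^ (e : ℕ))) :
    ρ x ∈ Submodule.span K (Set.range (milnorEltStretch p K e)) := by
  have hx : x ∈ Submodule.span K (Set.range (admMonomial K (p ^ (e : ℕ)))) := by
    rw [span_admMonomial]; exact Submodule.mem_top
  induction hx using Submodule.span_induction with
  | zero => rw [map_zero]; exact Submodule.zero_mem _
  | add x y _ _ hx hy => rw [map_add]; exact Submodule.add_mem _ hx hy
  | smul a x _ hx => rw [map_smul]; exact Submodule.smul_mem _ _ hx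
  | mem x hx =>
    obtain ⟨R, rfl⟩ := hx
    exact Submodule.span_mono (Set.image_subset_range _ _) (map_admMonomial_mem_degreeSpan hρ R)

variable (p K e) in
theorem existsUnique_isMilnorBasis :
    ∃! b : Module.Basis (ℕ+ →₀ ℕ) K (SteenrodAlg K (p ^ (e : ℕ))), IsMilnorBasis p K e b := by
  have hρ := milnorHom_power p K e
  have hinj := injective_of_map_power hρ
  choose x _ hx using exists_map_eq_milnorEltStretch hρ
  have hcomp : milnorHom p K e ∘ x = milnorEltStretch p K e := funext hx
  have hli : LinearIndependent K x := by
    refine LinearIndependent.of_comp (milnorHom p K e).toLinearMap ?_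
    change LinearIndependent K (milnorHom p K e ∘ x)
    rw [hcomp]
    exact linearIndependent_milnorEltStretch p K e
  have hspan : ⊤ ≤ Submodule.span K (Set.range x) := by
    intro y _
    have hy := map_mem_span_milnorEltStretch hρ y
    rw [← hcomp, Set.range_comp] at hy
    change _ ∈ Submodule.span K ((milnorHom p K e).toLinearMap '' _) at hy
    rw [← Submodule.map_span] at hy
    obtain ⟨z, hz, hzy⟩ := hy
    rwa [← hinj hzy]
  refine ⟨Module.Basis.mk hli hspan, ⟨milnorHom p K e, hρ, fun R => ?_⟩, ?_⟩
  · rw [Module.Basis.mk_apply, hx]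
  · rintro b ⟨ρ', hρ', hb⟩
    obtain rfl : ρ' = milnorHom p K e := steenrodAlg_algHom_ext fun r => (hρ' r).trans (hρ r).symm
    refine Module.Basis.eq_of_apply_eq fun R => hinj ?_
    rw [hb, Module.Basis.mk_apply, hx]

/-! ### The powers of the augmentation ideal are spanned by Milnor basis elements -/

section MayFiltration

variable {b : Module.Basis (ℕ+ →₀ ℕ) K (SteenrodAlg K (p ^ (e : ℕ)))}

theorem repr_eq (hb : ∀ R, ρ (b R) = milnorEltStretch p K e R)
    (x : SteenrodAlg K (p ^ (e : ℕ))) (T : ℕ+ →₀ ℕ) :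
    b.repr x T = (ρ x).ofConv (xiMonomial p K (stretch e T)) := by
  conv_rhs => rw [← b.linearCombination_repr x]
  rw [← linearCombination_milnorEltStretch_apply (p := p) (e := e) (b.repr x) T]
  congr 2
  have := Finsupp.apply_linearCombination K ρ.toLinearMap b (b.repr x)
  rw [show ρ.toLinearMap ∘ b = milnorEltStretch p K e from funext hb] at this
  exact this.symm

variable (p K) in
/-- Evaluation at `1`, the counit of Milnor's algebra. -/
def evalOne : MilnorAlg p K →ₐ[K] K :=
  AlgHom.ofLinearMap
    { toFun := fun f => f.ofConv 1
      map_add' := fun _ _ => rfl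
      map_smul' := fun _ _ => rfl }
    (by
      change (1 : MilnorAlg p K).ofConv 1 = 1
      rw [LinearMap.convOne_apply, Bialgebra.counit_one, map_one])
    (fun f g => by
      change (f * g).ofConv 1 = f.ofConv 1 * g.ofConv 1
      rw [LinearMap.convMul_apply, Bialgebra.comul_one, Algebra.TensorProduct.one_def,
        TensorProduct.map_tmul, LinearMap.mul'_apply])

/-- Identifies the coefficient of P(0) with the augmentation; both are algebra homomorphisms and
agree on the generators. -/
theorem evalOne_map
    (hρ : ∀ r : ℕ, ρ (power K (p ^ (e : ℕ)) r) = milnorEltStretch p K e (Finsupp.single 1 r))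
    (x : SteenrodAlg K (p ^ (e : ℕ))) : (ρ x).ofConv 1 = augmentation K (p ^ (e : ℕ)) x := by
  have : (evalOne p K).comp ρ = augmentation K (p ^ (e : ℕ)) := by
    refine steenrodAlg_algHom_ext fun r => ?_
    have h1 : (1 : MilnorDual p K) = xiMonomial p K (stretch e 0) := by
      rw [stretch, Finsupp.mapDomain_zero, xiMonomial, Finsupp.prod_zero_index]
    change (ρ (power K _ r)).ofConv 1 = _
    rw [hρ, h1, milnorEltStretch_apply_stretch]
    change _ = RingQuot.liftAlgHom K _ (RingQuot.mkAlgHom K _ _)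
    rw [RingQuot.liftAlgHom_mkAlgHom_apply, freeAugmentation, FreeAlgebra.lift_ι_apply]
    exact if_congr (by rw [eq_comm, Finsupp.single_eq_zero]) rfl rfl
  exact DFunLike.congr_fun this x

theorem repr_mul_eq_zero (hb : ∀ R, ρ (b R) = milnorEltStretch p K e R) {m n : ℕ}
    {x y : SteenrodAlg K (p ^ (e : ℕ))} (hx : ∀ T, weight p T < m → b.repr x T = 0)
    (hy : ∀ T, weight p T < n → b.repr y T = 0) (T : ℕ+ →₀ ℕ) (hT : weight p T < m + n) :
    b.repr (x * y) T = 0 := by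
  conv_lhs => rw [← b.linearCombination_repr x, ← b.linearCombination_repr y]
  rw [Finsupp.linearCombination_apply, Finsupp.linearCombination_apply, Finsupp.sum, Finsupp.sum,
    Finset.sum_mul_sum, map_sum, Finsupp.finsetSum_apply]
  refine Finset.sum_eq_zero fun R hR => ?_
  rw [map_sum, Finsupp.finsetSum_apply]
  refine Finset.sum_eq_zero fun S hS => ?_
  rw [smul_mul_smul_comm, map_smul, Finsupp.smul_apply, repr_eq hb (b R * b S), map_mul, hb, hb,
    milnorEltStretch_mul_apply]
  change _ • structConst p K e R S T = 0
  by_contra hne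
  have hc := (structConst_ne_zero p K e (right_ne_zero_of_mul hne)).2.2.1
  have hRm : m ≤ weight p R := by
    by_contra! h
    exact Finsupp.mem_support_iff.1 hR (hx R h)
  have hSn : n ≤ weight p S := by
    by_contra! h
    exact Finsupp.mem_support_iff.1 hS (hy S h)
  omega

/-- Forwards, weights are superadditive under products and elements of the augmentation ideal have
only terms of weight at least 1. Backwards, each P(T) already lies in the power of exponent w(T), as
injectivity of ρ transports the generation result back. -/
theorem mem_augIdeal_pow_iff
    (hρ : ∀ r : ℕ, ρ (power K (p ^ (e : ℕ)) r) = milnorEltStretch p K e (Finsupp.single 1 r))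
    (hb : ∀ R, ρ (b R) = milnorEltStretch p K e R) (m : ℕ) (x : SteenrodAlg K (p ^ (e : ℕ))) :
    x ∈ augIdeal K (p ^ (e : ℕ)) ^ m ↔ ∀ T ∈ (b.repr x).support, m ≤ weight p T := by
  constructor
  · suffices h : x ∈ augIdeal K (p ^ (e : ℕ)) ^ m → ∀ T, weight p T < m → b.repr x T = 0 by
      intro hx T hT
      by_contra! hlt
      exact Finsupp.mem_support_iff.1 hT (h hx T hlt)
    induction m generalizing x with
    | zero => exact fun _ T hT => absurd hT (Nat.not_lt_zero _)
    | succ m ih =>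
      intro hx
      rw [Submodule.pow_succ] at hx
      refine Submodule.mul_induction_on hx (fun x hx y hy => ?_) fun x y hx hy T hT => ?_
      · refine repr_mul_eq_zero hb (ih x hx) fun T hT => ?_
        -- Weight 0 occurs only at T = 0, and the coefficient there is the augmentation, which
        -- vanishes on the ideal.
        obtain rfl : T = 0 := eq_zero_of_weight_eq_zero p (by omega)
        rw [repr_eq hb, stretch, Finsupp.mapDomain_zero, xiMonomial, Finsupp.prod_zero_index,
          evalOne_map hρ]
        exact hy
      · rw [map_add, Finsupp.add_apply, hx T hT, hy T hT, add_zero]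
  · intro h
    rw [← b.linearCombination_repr x, Finsupp.linearCombination_apply]
    have hmem : ∀ T ∈ (b.repr x).support, b.repr x T • b T ∈
        (augIdeal K (p ^ (e : ℕ)) ^ m).restrictScalars K := by
      intro T hT
      refine Submodule.smul_mem _ _ ?_
      obtain ⟨y, hy, hyT⟩ := exists_map_eq_milnorEltStretch hρ T
      rw [← hb] at hyT
      rw [← injective_of_map_power hρ hyT]
      exact augIdeal_pow_anti (h T hT) hy
    exact Submodule.sum_mem ((augIdeal K (p ^ (e : ℕ)) ^ m).restrictScalars K) hmem

theorem mayFiltration_eq_inf_weight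
    (hρ : ∀ r : ℕ, ρ (power K (p ^ (e : ℕ)) r) = milnorEltStretch p K e (Finsupp.single 1 r))
    (hb : ∀ R, ρ (b R) = milnorEltStretch p K e R) (x : SteenrodAlg K (p ^ (e : ℕ))) :
    mayFiltration x = (b.repr x).support.inf fun T => (weight p T : ℕ∞) := by
  unfold mayFiltration
  simp only [mem_augIdeal_pow_iff hρ hb]
  refine le_antisymm (iSup₂_le fun m hm => Finset.le_inf fun T hT => ?_) ?_
  · exact_mod_cast hm T hT
  · rcases (b.repr x).support.eq_empty_or_nonempty with h | h
    -- For x = 0 membership holds for every m, so the supremum is ⊤, in agreement with the empty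
    -- infimum.
    · rw [h, Finset.inf_empty]
      simp only [Finset.notMem_empty, false_imp_iff, implies_true, iSup_pos]
      rw [ENat.iSup_natCast_eq_top.2]
      rintro ⟨N, hN⟩
      exact absurd (hN ⟨N + 1, rfl⟩) (by simp)
    · obtain ⟨T, hT, hinf⟩ := Finset.exists_mem_eq_inf _ h fun T => (weight p T : ℕ∞)
      rw [hinf]
      refine le_iSup₂_of_le (weight p T) (fun U hU => ?_) le_rfl
      have : (weight p T : ℕ∞) ≤ weight p U := hinf ▸ Finset.inf_le hU
      exact_mod_cast this

theorem mayFiltration_basis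
    (hρ : ∀ r : ℕ, ρ (power K (p ^ (e : ℕ)) r) = milnorEltStretch p K e (Finsupp.single 1 r))
    (hb : ∀ R, ρ (b R) = milnorEltStretch p K e R) (R : ℕ+ →₀ ℕ) :
    mayFiltration (b R) = weight p R := by
  rw [mayFiltration_eq_inf_weight hρ hb, b.repr_self,
    Finsupp.support_single R one_ne_zero, Finset.inf_singleton]

end MayFiltration

end MilnorBasis

end Steenrod

end

theorem proposition4p5 (p : ℕ) [Fact p.Prime] (e : ℕ+) (K : Type*) [Field K] [CharP K p]
    (hK : Nat.card K = p ^ (e : ℕ)) :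
    (∃! b : Module.Basis (ℕ+ →₀ ℕ) K (Steenrod.SteenrodAlg K (p ^ (e : ℕ))),
      Steenrod.IsMilnorBasis p K e b) ∧
    ∀ b : Module.Basis (ℕ+ →₀ ℕ) K (Steenrod.SteenrodAlg K (p ^ (e : ℕ))),
      Steenrod.IsMilnorBasis p K e b →
        (∀ θ : Steenrod.SteenrodAlg K (p ^ (e : ℕ)), θ ≠ 0 → Steenrod.mayFiltration θ ≠ ⊤) ∧
        ∀ θ : Steenrod.SteenrodAlg K (p ^ (e : ℕ)), Steenrod.mayFiltration θ =
          (b.repr θ).support.inf (fun R => Steenrod.mayFiltration (b R)) := by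
  refine ⟨Steenrod.existsUnique_isMilnorBasis p K e, ?_⟩
  rintro b ⟨ρ, hρ, hb⟩
  refine ⟨fun θ hθ => ?_, fun θ => ?_⟩
  · obtain ⟨T, hT⟩ := Finsupp.support_nonempty_iff.2
      (show b.repr θ ≠ 0 from fun h => hθ (b.repr.map_eq_zero_iff.1 h))
    rw [Steenrod.mayFiltration_eq_inf_weight hρ hb]
    exact ((Finset.inf_le hT).trans_lt (ENat.natCast_lt_top _)).ne
  · simp only [Steenrod.mayFiltration_basis hρ hb]
    exact Steenrod.mayFiltration_eq_inf_weight hρ hb θ
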